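/- Call the level of a rational matrix $Q$ the least integer $\ell\ge 1$ such that $\ell Q$ has integer entries, and let $\mathbb{O}_3(\ell,\mathbb{Q})$ be the set of rational orthogonal $3\times 3$ matrices of level $\ell$. For every $k\ge 1$ let $X_k$ be a random symmetric $3\times 3$ matrix whose upper-triangular entries (including the diagonal) are independent and uniformly distributed on $\{1,\dots,k\}$. Then, for every $L$, the limit over $k$ below exists, the limit over $L$ exists as well, and $$\lim_{L\to\infty}\lim_{k\to\infty}\mathbb{P}\Bigl(\exists\, Q\in\bigcup_{\ell=2}^{L}\mathbb{O}_3(\ell,\mathbb{Q}):\ Q^{\mathsf T}X_kQ\in\mathbb{Z}^{3\times 3}\Bigr)\ \le\ \frac{105\,\zeta(3)}{\pi^4}-1 = 0.29573\ldots,$$ where $\zeta$ is the Riemann zeta function and $\zeta(3)=\sum_{m=1}^\infty m^{-3}=1.2020569031\ldots$ is Apéry's constant. Moreover, $$\prod_{p\text{ odd prime}}\frac{1+p^{-3}}{1-p^{-2}}=\frac23\cdot\frac{\zeta(2)\zeta(3)}{\zeta(6)}=\frac{105\,\zeta(3)}{\pi^4}.$$ -/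

import Mathlib

open MeasureTheory ProbabilityTheory Filter Topology

/-- A rational matrix all of whose entries are integers. -/
def IsIntegerMatrix {n : ℕ} (M : Matrix (Fin n) (Fin n) ℚ) : Prop :=
  ∀ i j, ∃ z : ℤ, M i j = z

/-- `HasLevel Q ℓ`: the level of the rational matrix `Q` is `ℓ`, that is, `ℓ` is the least
positive integer such that `ℓ Q` has integer entries. -/
def HasLevel {n : ℕ} (Q : Matrix (Fin n) (Fin n) ℚ) (ℓ : ℕ) : Prop :=
  IsLeast {m : ℕ | 1 ≤ m ∧ IsIntegerMatrix ((m : ℚ) • Q)} ℓ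

/-- The set of all rational orthogonal `n × n` matrices of level `ℓ`. -/
def orthogonalOfLevel (n ℓ : ℕ) : Set (Matrix (Fin n) (Fin n) ℚ) :=
  {Q | Q ∈ Matrix.orthogonalGroup (Fin n) ℚ ∧ HasLevel Q ℓ}

/-- Orthogonality spelled out through the transpose. -/
theorem mem_orthogonalOfLevel_iff {n ℓ : ℕ} {Q : Matrix (Fin n) (Fin n) ℚ} :
    Q ∈ orthogonalOfLevel n ℓ ↔ Q.transpose * Q = 1 ∧ HasLevel Q ℓ := by
  exact and_congr_left' (Matrix.mem_orthogonalGroup_iff' (Fin n) ℚ)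

/-- For an integer matrix `X`: some rational orthogonal `Q` whose level lies in `{2, …, L}` has
the property that `Qᵀ X Q` is again an integer matrix. -/
def HasRationalConjugate {n : ℕ} (L : ℕ) (X : Matrix (Fin n) (Fin n) ℤ) : Prop :=
  ∃ ℓ ∈ Finset.Icc 2 L, ∃ Q ∈ orthogonalOfLevel n ℓ,
    IsIntegerMatrix (Q.transpose * X.map (Int.cast : ℤ → ℚ) * Q)

/-- `X` is a random symmetric integer `n × n` matrix whose upper-triangular entries
(diagonal included) are independent and uniformly distributed on `{1, …, k}`. -/
structure IsUniformSymmetric {Ω : Type*} [MeasurableSpace Ω] (P : Measure Ω) (n k : ℕ)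
    (X : Ω → Matrix (Fin n) (Fin n) ℤ) : Prop where
  isSymm : ∀ ω, (X ω).IsSymm
  measurable : ∀ i j, Measurable fun ω => X ω i j
  uniform : ∀ i j, i ≤ j →
    P.map (fun ω => X ω i j) = uniformOn (Set.Icc (1 : ℤ) (k : ℤ))
  indep : iIndepFun
    (fun (e : {e : Fin n × Fin n // e.1 ≤ e.2}) (ω : Ω) => X ω e.1.1 e.1.2) P

/-- Apéry's constant `ζ(3) = ∑_{m ≥ 1} 1 / m ^ 3`. -/
noncomputable def aperyConstant : ℝ := ∑' m : ℕ, 1 / ((m : ℝ) + 1) ^ 3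

/-! ### Apéry's constant -/

/-! Let `Q` have level `ℓ` and put `P = ℓ Q`, an integer matrix with `PᵀP = ℓ²` and no prime factor
of `ℓ` dividing all its entries. Squares modulo 4 force `ℓ` to be odd (`odd_level`). Since `adj P =
±ℓ Pᵀ`, all 2 × 2 minors of `P` vanish modulo `ℓ`, so modulo a prime power `q = p ^ r` exactly
dividing `ℓ` the columns of `P` are multiples of a single column `v` with a unit entry. If `Y =
QᵀXQ` is integral, then `XP = PY`, and therefore `v` is an eigenvector of `X` modulo `q`, while
`vᵀv` and `vᵀXv` vanish modulo `q²` (`mem_levelSet_of_isIntegerMatrix`).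

For one `v` these conditions cut out a proportion at most `q⁻² · q⁻¹` of the symmetric matrices
modulo `q²`. They depend only on the point of the conic `vᵀv = 0` modulo `q`, and there are at most
`p ^ r + p ^ (r - 1)` points to consider (`card_hasIsotropicEigenvector_le`). The local density is
thus at most `(1 + 1/p) p ^ (-2r)`. By the Chinese remainder theorem these bounds multiply over the
primes dividing `ℓ`; a union bound over `ℓ` and the Euler product then give the constant, the term
`ℓ = 1` accounting for the `-1` (`sum_levelWeight_le`).

The limit over `k` exists because the event depends only on `X` modulo `(L!)²`; the limit over `L`
exists by monotonicity and boundedness. -/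

theorem hasSum_aperyConstant : HasSum (fun m : ℕ => 1 / ((m : ℝ) + 1) ^ 3) aperyConstant := by
  have h : Summable (fun m : ℕ => 1 / ((m : ℝ) + 1) ^ 3) := by
    have := (summable_nat_add_iff 1).2 (Real.summable_one_div_nat_pow.2 (by norm_num : 1 < 3))
    simpa using this
  exact h.hasSum

theorem aperyConstant_eq_riemannZeta : (aperyConstant : ℂ) = riemannZeta 3 := by
  have h := zeta_nat_eq_tsum_of_gt_one (k := 3) (by norm_num)
  have h2 : HasSum (fun n : ℕ => 1 / (n : ℂ) ^ 3) (aperyConstant : ℂ) := by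
    rw [← hasSum_nat_add_iff' 1]
    have := Complex.hasSum_ofReal.2 hasSum_aperyConstant
    simpa using this
  rw [h2.tsum_eq] at h
  exact_mod_cast h.symm

theorem tendsto_partialSum_add {g : ℕ → ℝ} (hg : Tendsto g atTop (𝓝 0)) :
    Tendsto (fun M : ℕ => (∑ m ∈ Finset.range M, 1 / ((m : ℝ) + 1) ^ 3) + g M) atTop
      (𝓝 aperyConstant) := by
  simpa using hasSum_aperyConstant.tendsto_sum_nat.add hg

theorem tendsto_const_div_odd_pow (c : ℝ) {k : ℕ} (hk : k ≠ 0) :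
    Tendsto (fun M : ℕ => c / (2 * (M : ℝ) + 1) ^ k) atTop (𝓝 0) := by
  refine Tendsto.div_atTop tendsto_const_nhds ?_
  refine (tendsto_pow_atTop hk).comp ?_
  exact tendsto_atTop_add_const_right _ _
    ((tendsto_natCast_atTop_atTop).const_mul_atTop (by norm_num))

/-- The correction is the start of the midpoint Euler–Maclaurin expansion of the tail about `M +
1/2`. Cut off after a negative term, the corrected partial sums increase to the limit. -/
theorem aperyConstant_lower (M : ℕ) :
    (∑ m ∈ Finset.range M, 1 / ((m : ℝ) + 1) ^ 3) +
      (2 / (2 * (M : ℝ) + 1) ^ 2 - 2 / (2 * (M : ℝ) + 1) ^ 4) ≤ aperyConstant := by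
  have ht := tendsto_partialSum_add (g := fun M : ℕ =>
    2 / (2 * (M : ℝ) + 1) ^ 2 - 2 / (2 * (M : ℝ) + 1) ^ 4)
    (by simpa using (tendsto_const_div_odd_pow 2 two_ne_zero).sub
          (tendsto_const_div_odd_pow 2 four_ne_zero))
  refine Monotone.ge_of_tendsto (monotone_nat_of_le_succ fun n => ?_) ht M
  rw [Finset.sum_range_succ]
  push_cast
  have hx : (0 : ℝ) ≤ n := Nat.cast_nonneg n
  generalize (n : ℝ) = x at hx
  have key : 0 ≤ 1 / (x + 1) ^ 3 + (2 / (2 * (x + 1) + 1) ^ 2 - 2 / (2 * (x + 1) + 1) ^ 4) -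
      (2 / (2 * x + 1) ^ 2 - 2 / (2 * x + 1) ^ 4) := by
    rw [div_sub_div _ _ (by positivity) (by positivity),
      div_sub_div _ _ (by positivity) (by positivity),
      div_add_div _ _ (by positivity) (by positivity),
      div_sub_div _ _ (by positivity) (by positivity)]
    refine div_nonneg ?_ (by positivity)
    ring_nf
    positivity
  linarith

/-- One more term of the same expansion, with coefficient `14 / 3`, makes the corrected partial sums
decrease from `M = 1` on. -/
theorem aperyConstant_upper (M : ℕ) (hM : 1 ≤ M) :
    aperyConstant ≤ (∑ m ∈ Finset.range M, 1 / ((m : ℝ) + 1) ^ 3) +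
      (2 / (2 * (M : ℝ) + 1) ^ 2 - 2 / (2 * (M : ℝ) + 1) ^ 4 +
        14 / 3 / (2 * (M : ℝ) + 1) ^ 6) := by
  have ht := tendsto_partialSum_add (g := fun M : ℕ =>
    2 / (2 * (M : ℝ) + 1) ^ 2 - 2 / (2 * (M : ℝ) + 1) ^ 4 + 14 / 3 / (2 * (M : ℝ) + 1) ^ 6)
    (by simpa using ((tendsto_const_div_odd_pow 2 two_ne_zero).sub
          (tendsto_const_div_odd_pow 2 four_ne_zero)).add
            (tendsto_const_div_odd_pow (14 / 3) (by norm_num : 6 ≠ 0)))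
  have ht' := (tendsto_add_atTop_iff_nat 1).2 ht
  obtain ⟨N, rfl⟩ := Nat.exists_eq_add_of_le' hM
  refine Antitone.le_of_tendsto (antitone_nat_of_succ_le fun n => ?_) ht' N
  rw [Finset.sum_range_succ _ (n + 1)]
  push_cast
  have hx : (0 : ℝ) ≤ n := Nat.cast_nonneg n
  generalize (n : ℝ) = x at hx
  have key : 0 ≤ (2 / (2 * (x + 1) + 1) ^ 2 - 2 / (2 * (x + 1) + 1) ^ 4 +
      14 / 3 / (2 * (x + 1) + 1) ^ 6) - (1 / (x + 1 + 1) ^ 3 + (2 / (2 * (x + 1 + 1) + 1) ^ 2 -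
      2 / (2 * (x + 1 + 1) + 1) ^ 4 + 14 / 3 / (2 * (x + 1 + 1) + 1) ^ 6)) := by
    have e1 : 2 / (2 * (x + 1) + 1) ^ 2 - 2 / (2 * (x + 1) + 1) ^ 4 +
      14 / 3 / (2 * (x + 1) + 1) ^ 6 = (2 * (2 * (x + 1) + 1) ^ 4 - 2 * (2 * (x + 1) + 1) ^ 2 +
        14 / 3) / (2 * (x + 1) + 1) ^ 6 := by field_simp
    have e2 : 2 / (2 * (x + 1 + 1) + 1) ^ 2 - 2 / (2 * (x + 1 + 1) + 1) ^ 4 +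
      14 / 3 / (2 * (x + 1 + 1) + 1) ^ 6 = (2 * (2 * (x + 1 + 1) + 1) ^ 4 -
        2 * (2 * (x + 1 + 1) + 1) ^ 2 + 14 / 3) / (2 * (x + 1 + 1) + 1) ^ 6 := by field_simp
    rw [e1, e2, div_add_div _ _ (by positivity) (by positivity),
      div_sub_div _ _ (by positivity) (by positivity)]
    refine div_nonneg ?_ (by positivity)
    ring_nf
    positivity
  linarith

theorem aperyConstant_mem_Ico : aperyConstant ∈ Set.Ico (1.2020569031 : ℝ) 1.2020569032 := by
  constructor
  · refine le_trans ?_ (aperyConstant_lower 40)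
    norm_num [Finset.sum_range_succ]
  · refine lt_of_le_of_lt (aperyConstant_upper 40 (by norm_num)) ?_
    norm_num [Finset.sum_range_succ]

theorem bound_mem_Ico :
    105 * aperyConstant / Real.pi ^ 4 - 1 ∈ Set.Ico (0.29573 : ℝ) 0.29574 := by
  obtain ⟨h1, h2⟩ := aperyConstant_mem_Ico
  have hp := Real.pi_pos
  have h3 : (3.141592653 : ℝ) ^ 4 ≤ Real.pi ^ 4 := by
    have := Real.pi_gt_d20
    gcongr
    linarith
  have h4 : Real.pi ^ 4 ≤ (3.141592654 : ℝ) ^ 4 := by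
    have := Real.pi_lt_d20
    gcongr
    linarith
  have hp4 : 0 < Real.pi ^ 4 := by positivity
  constructor
  · rw [le_sub_iff_add_le, le_div_iff₀ hp4]
    norm_num at *
    linarith
  · rw [sub_lt_iff_lt_add, div_lt_iff₀ hp4]
    norm_num at *
    linarith

/-! ### The Euler product -/

theorem riemannZeta_six : riemannZeta 6 = (Real.pi : ℂ) ^ 6 / 945 := by
  have hb : bernoulli 6 = 1 / 42 := by
    rw [bernoulli_eq_bernoulli'_of_ne_one (by norm_num), bernoulli'_def]
    norm_num [Finset.sum_range_succ, bernoulli'_eq_zero_of_odd, Nat.choose]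
  have h := riemannZeta_two_mul_nat (k := 3) (by norm_num)
  norm_num [hb, Nat.factorial] at h
  rw [h]
  ring

theorem two_thirds_zeta_eq : ((105 * aperyConstant / Real.pi ^ 4 : ℝ) : ℂ) =
    2 / 3 * (riemannZeta 2 * riemannZeta 3 / riemannZeta 6) := by
  have hp : (Real.pi : ℂ) ≠ 0 := by exact_mod_cast Real.pi_ne_zero
  rw [riemannZeta_six, riemannZeta_two, ← aperyConstant_eq_riemannZeta]
  push_cast
  field_simp
  ring

/-- The Euler factor at `p`. -/
noncomputable def eulerFactor (p : ℕ) : ℝ := (1 + (p : ℝ) ^ (-3 : ℤ)) / (1 - (p : ℝ) ^ (-2 : ℤ))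

/-- Factor by factor, `1 + p⁻³ = (1 - p⁻⁶) / (1 - p⁻³)`. -/
theorem hasProd_eulerFactor_primes :
    HasProd (fun p : Nat.Primes => ((eulerFactor p : ℝ) : ℂ))
      (riemannZeta 2 * riemannZeta 3 / riemannZeta 6) := by
  have h2 := riemannZeta_eulerProduct_hasProd (s := 2) (by norm_num)
  have h3 := riemannZeta_eulerProduct_hasProd (s := 3) (by norm_num)
  have h6 := riemannZeta_eulerProduct_hasProd (s := 6) (by norm_num)
  have h6' : HasProd (fun p : Nat.Primes => ((1 - (p : ℂ) ^ (-6 : ℂ))⁻¹)⁻¹) (riemannZeta 6)⁻¹ := by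
    have := Tendsto.inv₀ h6 (riemannZeta_ne_zero_of_one_lt_re (by norm_num))
    refine this.congr fun s => ?_
    exact (Finset.prod_inv_distrib _).symm
  refine ((h2.mul h3).mul h6').congr_fun ?_
  intro p
  have hp : (1 : ℝ) < (p : ℕ) := by exact_mod_cast p.2.one_lt
  have hp0 : ((p : ℕ) : ℂ) ≠ 0 := by exact_mod_cast p.2.ne_zero
  have e2 : ((p : ℕ) : ℂ) ^ (-2 : ℂ) = (((p : ℕ) : ℂ) ^ 2)⁻¹ := by
    rw [Complex.cpow_neg]; norm_cast
  have e3 : ((p : ℕ) : ℂ) ^ (-3 : ℂ) = (((p : ℕ) : ℂ) ^ 3)⁻¹ := by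
    rw [Complex.cpow_neg]; norm_cast
  have e6 : ((p : ℕ) : ℂ) ^ (-6 : ℂ) = (((p : ℕ) : ℂ) ^ 6)⁻¹ := by
    rw [Complex.cpow_neg]; norm_cast
  have n2 : ((p : ℕ) : ℂ) ^ 2 - 1 ≠ 0 := by
    have : ((p : ℕ) : ℝ) ^ 2 - 1 ≠ 0 := by nlinarith
    exact_mod_cast this
  have n3 : ((p : ℕ) : ℂ) ^ 3 - 1 ≠ 0 := by
    have : ((p : ℕ) : ℝ) ^ 3 - 1 ≠ 0 := by
      have := one_lt_pow₀ hp (three_ne_zero)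
      linarith
    exact_mod_cast this
  rw [e2, e3, e6, eulerFactor]
  push_cast
  rw [zpow_neg, zpow_neg]
  norm_cast
  push_cast
  field_simp
  ring

theorem hasProd_eulerFactor_odd :
    HasProd (fun p : {p : ℕ // p.Prime ∧ Odd p} => eulerFactor p)
      (105 * aperyConstant / Real.pi ^ 4) := by
  have h0 : HasProd (fun p : Nat.Primes => eulerFactor p)
      (3 / 2 * (105 * aperyConstant / Real.pi ^ 4)) := by
    have h := hasProd_eulerFactor_primes
    have e : riemannZeta 2 * riemannZeta 3 / riemannZeta 6 =
        ((3 / 2 * (105 * aperyConstant / Real.pi ^ 4) : ℝ) : ℂ) := by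
      rw [Complex.ofReal_mul, two_thirds_zeta_eq]
      push_cast
      ring
    rw [e] at h
    unfold HasProd at h ⊢
    refine Filter.tendsto_ofReal_iff.1 (h.congr fun s => ?_)
    simp
  have hf2 : eulerFactor 2 = 3 / 2 := by
    rw [eulerFactor, zpow_neg, zpow_neg]
    norm_num
  have hr : HasProd (fun p : Nat.Primes => (if (p : ℕ) = 2 then 1 else eulerFactor p))
      (105 * aperyConstant / Real.pi ^ 4) := by
    -- Multiplying by a product supported at the prime 2 cancels its Euler factor `3 / 2`.
    have hs : HasProd (fun p : Nat.Primes => if (p : ℕ) = 2 then (2 / 3 : ℝ) else 1) (2 / 3) :=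
      hasProd_single (⟨2, Nat.prime_two⟩ : Nat.Primes) fun p hp =>
        if_neg fun h => hp (Nat.Primes.coe_nat_injective h)
    have e : 2 / 3 * (3 / 2 * (105 * aperyConstant / Real.pi ^ 4)) =
      105 * aperyConstant / Real.pi ^ 4 := by ring
    rw [← e]
    refine (hs.mul h0).congr_fun fun p => ?_
    by_cases hp : (p : ℕ) = 2
    · rw [if_pos hp, if_pos hp, hp, hf2]
      norm_num
    · rw [if_neg hp, if_neg hp, one_mul]
  let i : {p : ℕ // p.Prime ∧ Odd p} → Nat.Primes := fun p => ⟨p.1, p.2.1⟩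
  have hi : Function.Injective i := fun p q h => 
    Subtype.ext (congrArg (fun r : Nat.Primes => (r : ℕ)) h)
  rw [← hi.hasProd_iff] at hr
  · refine hr.congr_fun fun p => ?_
    have : (p : ℕ) ≠ 2 := by
      rintro h
      have := p.2.2
      rw [h] at this
      exact absurd this (by decide)
    exact (if_neg this).symm
  · intro p hp
    by_cases h2 : (p : ℕ) = 2
    · simp [h2]
    · exact absurd ⟨⟨p.1, p.2, p.2.odd_of_ne_two h2⟩, rfl⟩ hp

theorem one_le_eulerFactor {p : ℕ} (hp : p.Prime) : 1 ≤ eulerFactor p := by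
  have h1 : (1 : ℝ) < p := by exact_mod_cast hp.one_lt
  rw [eulerFactor, zpow_neg, zpow_neg]
  norm_cast
  push_cast
  have h2 : ((p : ℝ) ^ 2)⁻¹ < 1 := inv_lt_one_of_one_lt₀ (one_lt_pow₀ h1 two_ne_zero)
  rw [one_le_div (by linarith)]
  have : (0 : ℝ) < ((p : ℝ) ^ 2)⁻¹ := by positivity
  have : (0 : ℝ) < ((p : ℝ) ^ 3)⁻¹ := by positivity
  linarith

theorem prod_eulerFactor_le (s : Finset {p : ℕ // p.Prime ∧ Odd p}) :
    ∏ p ∈ s, eulerFactor p ≤ 105 * aperyConstant / Real.pi ^ 4 := by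
  have h := hasProd_eulerFactor_odd
  rw [HasProd, SummationFilter.unconditional_filter] at h
  refine ge_of_tendsto h ?_
  filter_upwards [eventually_ge_atTop s] with t ht
  rw [← Finset.prod_sdiff ht]
  refine le_mul_of_one_le_left ?_ ?_
  · exact Finset.prod_nonneg fun p _ => zero_le_one.trans (one_le_eulerFactor p.2.1)
  · exact Finset.prod_induction _ (fun x => 1 ≤ x)
      (fun a b ha hb => one_le_mul_of_one_le_of_one_le ha hb) le_rfl
      fun p _ => one_le_eulerFactor p.2.1

/-! ### Symmetric matrices with an isotropic eigenvector over a local ring -/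

/-- Positions on or above the diagonal of a `3 × 3` matrix. -/
abbrev UpperIndex : Type := {e : Fin 3 × Fin 3 // e.1 ≤ e.2}

/-- The symmetric matrix with prescribed entries on and above the diagonal. -/
def symmetricOf {R : Type*} (x : UpperIndex → R) : Matrix (Fin 3) (Fin 3) R :=
  fun i j => x ⟨(min i j, max i j), min_le_max⟩

theorem symmetricOf_comm {R : Type*} (x : UpperIndex → R) (i j : Fin 3) :
    symmetricOf x i j = symmetricOf x j i := by
  simp only [symmetricOf, min_comm, max_comm]

theorem symmetricOf_isSymm {R : Type*} (x : UpperIndex → R) : (symmetricOf x).IsSymm :=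
  Matrix.IsSymm.ext fun i j => symmetricOf_comm x j i

theorem symmetricOf_injective {R : Type*} :
    Function.Injective (symmetricOf : (UpperIndex → R) → Matrix (Fin 3) (Fin 3) R) := by
  intro x y h
  funext ⟨⟨i, j⟩, hij⟩
  have := congrFun (congrFun h i) j
  simpa only [symmetricOf, min_eq_left hij, max_eq_right hij] using this

/-- `X` has a primitive isotropic vector `v` with `vᵀ X v = 0` that is an eigenvector of `X`
modulo `I`. -/
def HasIsotropicEigenvector {R : Type*} [CommRing R] (I : Ideal R)
    (X : Matrix (Fin 3) (Fin 3) R) : Prop :=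
  ∃ v : Fin 3 → R, (∃ i, IsUnit (v i)) ∧ v ⬝ᵥ v = 0 ∧ v ⬝ᵥ X.mulVec v = 0 ∧
    ∃ c, ∀ i, X.mulVec v i - c * v i ∈ I

section LocalCount

variable {R : Type*} [CommRing R]

/-- The congruence `S ↦ MᵀSM` is injective on symmetric matrices. Of the six free entries of the
image one is zero, one lies in `I`, and four are arbitrary. -/
theorem card_symmetric_le [Finite R] (I : Ideal R) (M : Matrix (Fin 3) (Fin 3) R)
    (hM : IsUnit M.det) :
    Nat.card {x : UpperIndex → R // (M.transpose * symmetricOf x * M) 0 0 = 0 ∧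
      (M.transpose * symmetricOf x * M) 0 1 ∈ I} ≤ Nat.card I * Nat.card R ^ 4 := by
  let Y : (UpperIndex → R) → Matrix (Fin 3) (Fin 3) R := fun x => M.transpose * symmetricOf x * M
  have hY : ∀ x i j, Y x i j = Y x j i := by
    intro x i j
    have : (Y x).IsSymm := by
      simp only [Y, Matrix.IsSymm, Matrix.transpose_mul, Matrix.transpose_transpose,
        (symmetricOf_isSymm x).eq, Matrix.mul_assoc]
    exact this.apply j i
  let φ : {x : UpperIndex → R // Y x 0 0 = 0 ∧ Y x 0 1 ∈ I} → I × R × R × R × R :=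
    fun x => (⟨Y x 0 1, x.2.2⟩, Y x 0 2, Y x 1 1, Y x 1 2, Y x 2 2)
  have hφ : Function.Injective φ := by
    intro x x' h
    simp only [φ, Prod.mk.injEq, Subtype.mk.injEq] at h
    obtain ⟨h01, h02, h11, h12, h22⟩ := h
    have hYY : Y x = Y x' := by
      ext i j
      fin_cases i <;> fin_cases j <;> simp only [Fin.zero_eta, Fin.mk_one, Fin.reduceFinMk]
      · rw [x.2.1, x'.2.1]
      · exact h01
      · exact h02
      · rw [hY, h01, hY]
      · exact h11
      · exact h12
      · rw [hY, h02, hY]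
      · rw [hY, h12, hY]
      · exact h22
    apply Subtype.ext
    apply symmetricOf_injective
    have hMt : IsUnit M.transpose.det := by rwa [Matrix.det_transpose]
    have h1 : M.transpose * symmetricOf x.1 = M.transpose * symmetricOf x'.1 := by
      have := congrArg (· * M⁻¹) hYY
      simpa only [Y, Matrix.mul_nonsing_inv_cancel_right _ _ hM] using this
    have := congrArg (M.transpose⁻¹ * ·) h1
    simpa only [Matrix.nonsing_inv_mul_cancel_left _ _ hMt] using this
  have := Nat.card_le_card_of_injective φ hφ
  simp only [Nat.card_prod] at this
  refine this.trans (le_of_eq ?_)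
  ring

/-- A parametrization of the isotropic vectors, where `a ^ 2 + b ^ 2 = -1`. -/
def isoVec (a b t : R) : Fin 3 → R :=
  ![a - 2 * b * t - a * t ^ 2, b + 2 * a * t - b * t ^ 2, 1 + t ^ 2]

/-- Half of the derivative of `isoVec` with respect to the parameter. -/
def isoTangent (a b t : R) : Fin 3 → R := ![-b - a * t, a - b * t, t]

/-- The condition that the isotropic vector with parameter `t` imposes on `X`. -/
def IsoCondition (I : Ideal R) (X : Matrix (Fin 3) (Fin 3) R) (a b t : R) : Prop :=
  isoVec a b t ⬝ᵥ X.mulVec (isoVec a b t) = 0 ∧ isoVec a b t ⬝ᵥ X.mulVec (isoTangent a b t) ∈ I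

theorem card_isoCondition_le [Finite R] (I : Ideal R) (h2 : IsUnit (2 : R)) {a b : R}
    (hab : a ^ 2 + b ^ 2 = -1) (t : R) :
    Nat.card {x : UpperIndex → R // IsoCondition I (symmetricOf x) a b t} ≤
      Nat.card I * Nat.card R ^ 4 := by
  -- The third column `(-a, -b, 1)` is the derivative of the tangent in `t`; it completes the first
  -- two to a basis, since 2 is a unit.
  let M : Matrix (Fin 3) (Fin 3) R :=
    (Matrix.of ![isoVec a b t, isoTangent a b t, ![-a, -b, 1]]).transpose
  have hdet : M.det = -2 := by
    rw [Matrix.det_transpose, Matrix.det_fin_three]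
    simp [isoVec, isoTangent]
    linear_combination (2 : R) * hab
  have hM : IsUnit M.det := by
    rw [hdet]
    exact h2.neg
  have e : ∀ x : UpperIndex → R, IsoCondition I (symmetricOf x) a b t ↔
      ((M.transpose * symmetricOf x * M) 0 0 = 0 ∧
      (M.transpose * symmetricOf x * M) 0 1 ∈ I) := by
    intro x
    have e0 : (M.transpose * symmetricOf x * M) 0 0 =
        isoVec a b t ⬝ᵥ (symmetricOf x).mulVec (isoVec a b t) := by
      rw [Matrix.mul_assoc]
      rfl
    have e1 : (M.transpose * symmetricOf x * M) 0 1 =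
        isoVec a b t ⬝ᵥ (symmetricOf x).mulVec (isoTangent a b t) := by
      rw [Matrix.mul_assoc]
      rfl
    rw [e0, e1, IsoCondition]
  simp only [e]
  exact card_symmetric_le I M hM

/-- As `I² = 0`, moving `t` by `i ∈ I` changes the isotropic vector by `2i` times the tangent. The
quadratic form then changes by `4i` times an element of `I` plus a multiple of `i²`, that is, not at
all. Hence only `t` modulo `I` has to be counted. -/
theorem IsoCondition.add {I : Ideal R} (hI : ∀ x ∈ I, ∀ y ∈ I, x * y = 0)
    {x : UpperIndex → R} {a b t i : R} (hi : i ∈ I)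
    (h : IsoCondition I (symmetricOf x) a b t) :
    IsoCondition I (symmetricOf x) a b (t + i) := by
  obtain ⟨h1, h2⟩ := h
  have hii : i * i = 0 := hI i hi i hi
  have ev : isoVec a b (t + i) = isoVec a b t + (2 * i) • isoTangent a b t := by
    funext k
    fin_cases k <;> simp [isoVec, isoTangent]
    · linear_combination (-a) * hii
    · linear_combination (-b) * hii
    · linear_combination hii
  have ew : isoTangent a b (t + i) = isoTangent a b t + i • ![-a, -b, 1] := by
    funext k
    fin_cases k <;> simp [isoTangent] <;> ring
  have hc : isoTangent a b t ⬝ᵥ (symmetricOf x).mulVec (isoVec a b t) =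
      isoVec a b t ⬝ᵥ (symmetricOf x).mulVec (isoTangent a b t) := by
    rw [Matrix.dotProduct_mulVec, ← Matrix.mulVec_transpose, (symmetricOf_isSymm x).eq,
      dotProduct_comm]
  have h3 := hI i hi _ h2
  constructor
  · rw [ev]
    simp only [Matrix.mulVec_add, Matrix.mulVec_smul, dotProduct_add, add_dotProduct,
      smul_dotProduct, dotProduct_smul, smul_eq_mul, hc, h1]
    linear_combination 4 * h3 + 4 * (isoTangent a b t ⬝ᵥ
      (symmetricOf x).mulVec (isoTangent a b t)) * hii
  · rw [ev, ew]
    simp only [Matrix.mulVec_add, Matrix.mulVec_smul, dotProduct_add, add_dotProduct,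
      smul_dotProduct, dotProduct_smul, smul_eq_mul]
    refine I.add_mem (I.add_mem h2 ?_) (I.mul_mem_right _ hi)
    exact I.mul_mem_right _ (I.mul_mem_left _ hi)

theorem isoVec_dotProduct_isoTangent {a b : R} (hab : a ^ 2 + b ^ 2 = -1) (t : R) :
    isoVec a b t ⬝ᵥ isoTangent a b t = 0 := by
  simp [isoVec, isoTangent, dotProduct, Fin.sum_univ_three]
  linear_combination (t + t ^ 3) * hab

/-- Stereographic projection: on `v = y • isoVec a b t` the linear forms `v 2 - a v 0 - b v 1` and
`b v 0 - a v 1` take the values `2y` and `2yt`, so `y` and `t` can be recovered when `y` is a unit.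
The eigenvector condition enters through `vᵀXw ≡ c vᵀw = 0` for the tangent `w`. -/
theorem isoCondition_of_isUnit {I : Ideal R} {x : UpperIndex → R} {v : Fin 3 → R} {a b u : R}
    (hab : a ^ 2 + b ^ 2 = -1) (hu : 2 * u = 1) (hv : v ⬝ᵥ v = 0)
    (hX : v ⬝ᵥ (symmetricOf x).mulVec v = 0)
    (hc : ∃ c, ∀ i, (symmetricOf x).mulVec v i - c * v i ∈ I) {z : R}
    (hz : u * (v 2 - a * v 0 - b * v 1) * z = 1) :
    IsoCondition I (symmetricOf x) a b (u * z * (b * v 0 - a * v 1)) := by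
  obtain ⟨c, hc⟩ := hc
  set t := u * z * (b * v 0 - a * v 1) with ht
  set y := u * (v 2 - a * v 0 - b * v 1) with hy
  simp only [dotProduct, Fin.sum_univ_three] at hv
  have hq : (b * v 0 - a * v 1) ^ 2 = 2 * y * (a * v 0 + b * v 1 + v 2) := by
    rw [hy]
    linear_combination (-(v 2 - a * v 0 - b * v 1) * (a * v 0 + b * v 1 + v 2)) * hu +
      (v 0 ^ 2 + v 1 ^ 2) * hab - hv
  have ht1 : y * t = u * (b * v 0 - a * v 1) := by
    rw [ht]
    linear_combination u * (b * v 0 - a * v 1) * hz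
  have ht2 : y * t ^ 2 = u * (a * v 0 + b * v 1 + v 2) := by
    rw [ht]
    linear_combination u ^ 2 * (b * v 0 - a * v 1) ^ 2 * z * hz + u ^ 2 * z * hq +
      u * (a * v 0 + b * v 1 + v 2) * (2 * u) * hz + u * (a * v 0 + b * v 1 + v 2) * hu
  have hvt : v = y • isoVec a b t := by
    funext k
    fin_cases k <;> simp [isoVec]
    · linear_combination 2 * b * ht1 + a * ht2 - a * hy + v 0 * hab +
        (b * (b * v 0 - a * v 1) + a * (a * v 0 + b * v 1)) * hu
    · linear_combination -2 * a * ht1 + b * ht2 - b * hy + v 1 * hab +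
        (-a * (b * v 0 - a * v 1) + b * (a * v 0 + b * v 1)) * hu
    · linear_combination -ht2 - hy - v 2 * hu
  have hvt' : isoVec a b t = z • v := by
    rw [hvt, smul_smul, mul_comm z, hz, one_smul]
  constructor
  · rw [hvt', Matrix.mulVec_smul, smul_dotProduct, dotProduct_smul, hX]
    simp
  · have hvw : v ⬝ᵥ isoTangent a b t = 0 := by
      rw [hvt, smul_dotProduct, isoVec_dotProduct_isoTangent hab, smul_zero]
    have e : isoVec a b t ⬝ᵥ (symmetricOf x).mulVec (isoTangent a b t) =
        z * ∑ i, ((symmetricOf x).mulVec v i - c * v i) * isoTangent a b t i := by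
      have e1 : ∑ i, ((symmetricOf x).mulVec v i - c * v i) * isoTangent a b t i =
          (symmetricOf x).mulVec v ⬝ᵥ isoTangent a b t - c * (v ⬝ᵥ isoTangent a b t) := by
        simp only [dotProduct, Finset.mul_sum, ← Finset.sum_sub_distrib]
        exact Finset.sum_congr rfl fun i _ => by ring
      rw [e1, hvw, hvt', smul_dotProduct, Matrix.dotProduct_mulVec, ← Matrix.mulVec_transpose,
        (symmetricOf_isSymm x).eq]
      simp
    rw [e]
    exact I.mul_mem_left _ (I.sum_mem fun i _ => I.mul_mem_right _ (hc i))

theorem exists_sq_add_sq_eq_neg_one {v : Fin 3 → R} (hv : v ⬝ᵥ v = 0) (h : ∃ i, IsUnit (v i)) :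
    ∃ a b : R, a ^ 2 + b ^ 2 = -1 := by
  simp only [dotProduct, Fin.sum_univ_three] at hv
  obtain ⟨i, hi⟩ := h
  obtain ⟨z, hz⟩ := hi.exists_right_inv
  fin_cases i <;> simp only [Fin.zero_eta, Fin.mk_one, Fin.reduceFinMk] at hz
  · exact ⟨v 1 * z, v 2 * z, by linear_combination z ^ 2 * hv - (v 0 * z + 1) * hz⟩
  · exact ⟨v 0 * z, v 2 * z, by linear_combination z ^ 2 * hv - (v 1 * z + 1) * hz⟩
  · exact ⟨v 0 * z, v 1 * z, by linear_combination z ^ 2 * hv - (v 2 * z + 1) * hz⟩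

/-- The chart around `(a, b, 1)` misses the residue class of the opposite point `(-a, -b, 1)`. The
chart centred there covers that class with a non-unit parameter. -/
theorem exists_isoCondition [IsLocalRing R] {I : Ideal R} {x : UpperIndex → R} {a b : R}
    (hab : a ^ 2 + b ^ 2 = -1) (h2 : IsUnit (2 : R))
    (h : HasIsotropicEigenvector I (symmetricOf x)) :
    (∃ t, IsoCondition I (symmetricOf x) a b t) ∨
      ∃ t, ¬ IsUnit t ∧ IsoCondition I (symmetricOf x) (-a) (-b) t := by
  obtain ⟨v, hprim, hv, hX, hc⟩ := h
  obtain ⟨u, hu⟩ := h2.exists_right_inv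
  have hab' : (-a) ^ 2 + (-b) ^ 2 = -1 := by rw [neg_sq, neg_sq, hab]
  by_cases h1 : IsUnit (u * (v 2 - a * v 0 - b * v 1))
  · obtain ⟨z, hz⟩ := h1.exists_right_inv
    exact Or.inl ⟨_, isoCondition_of_isUnit hab hu hv hX hc hz⟩
  right
  have hvv := hv
  simp only [dotProduct, Fin.sum_univ_three] at hvv
  have hm : ∀ r : R, ¬ IsUnit r ↔ r ∈ IsLocalRing.maximalIdeal R := fun r => by
    rw [IsLocalRing.mem_maximalIdeal, mem_nonunits_iff]
  rw [hm] at h1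
  -- Its square is a multiple of the non-unit `y`, and the maximal ideal is prime.
  have hs : b * v 0 - a * v 1 ∈ IsLocalRing.maximalIdeal R := by
    refine (IsLocalRing.maximalIdeal.isMaximal R).isPrime.mem_of_pow_mem 2 ?_
    have : (b * v 0 - a * v 1) ^ 2 = u * (v 2 - a * v 0 - b * v 1) *
        (2 * (a * v 0 + b * v 1 + v 2)) := by
      linear_combination (-(v 2 - a * v 0 - b * v 1) * (a * v 0 + b * v 1 + v 2)) * hu +
        (v 0 ^ 2 + v 1 ^ 2) * hab - hvv
    rw [this]
    exact Ideal.mul_mem_right _ _ h1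
  have h3 : IsUnit (u * (v 2 - -a * v 0 - -b * v 1)) := by
    by_contra h3
    rw [hm] at h3
    have hv2 : v 2 ∈ IsLocalRing.maximalIdeal R := by
      have := Ideal.add_mem _ h1 h3
      convert this using 1
      linear_combination (-(v 2)) * hu
    have hs2 : a * v 0 + b * v 1 ∈ IsLocalRing.maximalIdeal R := by
      have := Ideal.sub_mem _ h3 h1
      convert this using 1
      linear_combination (-(a * v 0 + b * v 1)) * hu
    have hv0 : v 0 ∈ IsLocalRing.maximalIdeal R := by
      have := Ideal.add_mem _ (Ideal.mul_mem_left _ (-b) hs) (Ideal.mul_mem_left _ (-a) hs2)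
      convert this using 1
      linear_combination v 0 * hab
    have hv1 : v 1 ∈ IsLocalRing.maximalIdeal R := by
      have := Ideal.add_mem _ (Ideal.mul_mem_left _ a hs) (Ideal.mul_mem_left _ (-b) hs2)
      convert this using 1
      linear_combination v 1 * hab
    obtain ⟨i, hi⟩ := hprim
    have : v i ∈ IsLocalRing.maximalIdeal R := by
      fin_cases i
      · exact hv0
      · exact hv1
      · exact hv2
    rw [← hm] at this
    exact this hi
  obtain ⟨z, hz⟩ := h3.exists_right_inv
  refine ⟨_, ?_, isoCondition_of_isUnit hab' hu hv hX hc hz⟩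
  rw [hm]
  have := Ideal.mul_mem_left _ (-(u * z)) hs
  convert this using 1
  ring

theorem card_hasIsotropicEigenvector_le [IsLocalRing R] [Finite R] {I : Ideal R}
    (hI : ∀ x ∈ I, ∀ y ∈ I, x * y = 0) (h2 : IsUnit (2 : R)) (T T' : Finset R)
    (hT : ∀ t, ∃ s ∈ T, s - t ∈ I) (hT' : ∀ t, ¬ IsUnit t → ∃ s ∈ T', s - t ∈ I) :
    Nat.card {x : UpperIndex → R // HasIsotropicEigenvector I (symmetricOf x)} ≤
      (T.card + T'.card) * (Nat.card I * Nat.card R ^ 4) := by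
  classical
  have : Fintype R := Fintype.ofFinite R
  -- A solution of `a² + b² = -1` is needed only if some matrix is counted, and then its isotropic
  -- vector supplies one.
  rcases isEmpty_or_nonempty {x : UpperIndex → R // HasIsotropicEigenvector I (symmetricOf x)}
    with h | ⟨x₀, v, hprim, hv, -⟩
  · rw [Nat.card_of_isEmpty]
    exact Nat.zero_le _
  obtain ⟨a, b, hab⟩ := exists_sq_add_sq_eq_neg_one hv hprim
  have hab' : (-a) ^ 2 + (-b) ^ 2 = -1 := by rw [neg_sq, neg_sq, hab]
  let S : R → R → R → Finset (UpperIndex → R) := fun a b t =>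
    Finset.univ.filter fun x => IsoCondition I (symmetricOf x) a b t
  have hS : ∀ a b t, a ^ 2 + b ^ 2 = -1 → (S a b t).card ≤ Nat.card I * Nat.card R ^ 4 := by
    intro a b t hab
    rw [← Fintype.card_subtype, ← Nat.card_eq_fintype_card]
    exact card_isoCondition_le I h2 hab t
  have hsub : (Finset.univ.filter fun x : UpperIndex → R =>
      HasIsotropicEigenvector I (symmetricOf x)) ⊆
      T.biUnion (S a b) ∪ T'.biUnion (S (-a) (-b)) := by
    intro x hx
    rw [Finset.mem_filter] at hx
    rw [Finset.mem_union, Finset.mem_biUnion, Finset.mem_biUnion]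
    rcases exists_isoCondition hab h2 hx.2 with ⟨t, ht⟩ | ⟨t, htu, ht⟩
    · obtain ⟨s, hs, hst⟩ := hT t
      refine Or.inl ⟨s, hs, ?_⟩
      have := ht.add hI hst
      rw [add_sub_cancel] at this
      simpa [S] using this
    · obtain ⟨s, hs, hst⟩ := hT' t htu
      refine Or.inr ⟨s, hs, ?_⟩
      have := ht.add hI hst
      rw [add_sub_cancel] at this
      simpa [S] using this
  rw [Nat.card_eq_fintype_card, Fintype.card_subtype]
  refine (Finset.card_le_card hsub).trans ((Finset.card_union_le _ _).trans ?_)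
  rw [add_mul]
  exact add_le_add (Finset.card_biUnion_le_card_mul _ _ _ fun t _ => hS a b t hab)
    (Finset.card_biUnion_le_card_mul _ _ _ fun t _ => hS _ _ t hab')

end LocalCount

/-! ### Counting modulo prime powers and modulo the square of the level -/

theorem ZMod.isUnit_natCast_pow_pow_iff {p r : ℕ} (hp : p.Prime) (hr : r ≠ 0) (k : ℕ) :
    IsUnit (k : ZMod ((p ^ r) ^ 2)) ↔ ¬ p ∣ k := by
  rw [← pow_mul]
  exact ZMod.isUnit_natCast_iff_not_dvd_pow hp (by positivity)

theorem ZMod.isLocalRing_pow_pow {p r : ℕ} (hp : p.Prime) (hr : r ≠ 0) :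
    IsLocalRing (ZMod ((p ^ r) ^ 2)) := by
  have : NeZero ((p ^ r) ^ 2) := ⟨by have := hp.pos; positivity⟩
  have : Nontrivial (ZMod ((p ^ r) ^ 2)) := by
    rw [← pow_mul]
    exact ZMod.nontrivial_iff.2 (one_lt_pow₀ hp.one_lt (by positivity)).ne'
  refine IsLocalRing.of_nonunits_add fun a b ha hb => ?_
  rw [← ZMod.natCast_zmod_val a, mem_nonunits_iff, isUnit_natCast_pow_pow_iff hp hr, not_not] at ha
  rw [← ZMod.natCast_zmod_val b, mem_nonunits_iff, isUnit_natCast_pow_pow_iff hp hr, not_not] at hb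
  rw [← ZMod.natCast_zmod_val a, ← ZMod.natCast_zmod_val b, ← Nat.cast_add, mem_nonunits_iff,
    isUnit_natCast_pow_pow_iff hp hr, not_not]
  exact dvd_add ha hb

theorem ZMod.card_span_natCast_le {q : ℕ} (hq : 0 < q) :
    Nat.card (Ideal.span {(q : ZMod (q ^ 2))}) ≤ q := by
  have : NeZero (q ^ 2) := ⟨by positivity⟩
  let f : Fin q → Ideal.span {(q : ZMod (q ^ 2))} := fun j =>
    ⟨q * (j : ℕ), Ideal.mul_mem_right _ _ (Ideal.mem_span_singleton_self _)⟩
  have hf : Function.Surjective f := by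
    rintro ⟨x, hx⟩
    obtain ⟨c, rfl⟩ := Ideal.mem_span_singleton.1 hx
    refine ⟨⟨c.val % q, Nat.mod_lt _ hq⟩, Subtype.ext ?_⟩
    have h : c = ((q * (c.val / q) + c.val % q : ℕ) : ZMod (q ^ 2)) := by
      rw [Nat.div_add_mod, ZMod.natCast_zmod_val]
    have hz : (q : ZMod (q ^ 2)) * q = 0 := by
      have := ZMod.natCast_self (q ^ 2)
      rw [pow_two q] at this ⊢
      exact_mod_cast this
    change (q : ZMod (q ^ 2)) * ((c.val % q : ℕ) : ZMod (q ^ 2)) = q * c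
    conv_rhs => rw [h]
    push_cast
    linear_combination (-((c.val / q : ℕ) : ZMod (q ^ 2))) * hz
  simpa using Nat.card_le_card_of_surjective f hf

/-- Symmetric matrices modulo `q ^ 2` with an isotropic vector that is an eigenvector
modulo `q`. -/
def isotropicSet (q : ℕ) : Set (UpperIndex → ZMod (q ^ 2)) :=
  {x | HasIsotropicEigenvector (Ideal.span {(q : ZMod (q ^ 2))}) (symmetricOf x)}

theorem card_isotropicSet_le {p r : ℕ} (hp : p.Prime) (hp2 : p ≠ 2) (hr : r ≠ 0) :
    Nat.card (isotropicSet (p ^ r)) ≤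
      (p ^ r + p ^ (r - 1)) * (p ^ r * ((p ^ r) ^ 2) ^ 4) := by
  classical
  have := ZMod.isLocalRing_pow_pow hp hr
  have hq : 0 < p ^ r := pow_pos hp.pos r
  have : NeZero ((p ^ r) ^ 2) := ⟨by positivity⟩
  have hz : ((p ^ r : ℕ) : ZMod ((p ^ r) ^ 2)) * (p ^ r : ℕ) = 0 := by
    rw [← Nat.cast_mul, ← pow_two, ZMod.natCast_self]
  have h2 : IsUnit (2 : ZMod ((p ^ r) ^ 2)) := by
    have := (ZMod.isUnit_natCast_pow_pow_iff hp hr 2).2 fun h =>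
      hp2 ((Nat.prime_dvd_prime_iff_eq hp Nat.prime_two).1 h)
    exact_mod_cast this
  -- Parameters modulo `p ^ r` need `p ^ r` representatives. The non-units among them are multiples
  -- of `p` and need only `p ^ (r - 1)`.
  have h := card_hasIsotropicEigenvector_le
    (I := Ideal.span {((p ^ r : ℕ) : ZMod ((p ^ r) ^ 2))}) ?_ h2
    ((Finset.range (p ^ r)).image fun j : ℕ => (j : ZMod ((p ^ r) ^ 2)))
    ((Finset.range (p ^ (r - 1))).image fun j : ℕ => ((p * j : ℕ) : ZMod ((p ^ r) ^ 2))) ?_ ?_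
  · refine h.trans (Nat.mul_le_mul (add_le_add ?_ ?_) (Nat.mul_le_mul ?_ ?_))
    · exact Finset.card_image_le.trans (Finset.card_range _).le
    · exact Finset.card_image_le.trans (Finset.card_range _).le
    · exact ZMod.card_span_natCast_le hq
    · rw [Nat.card_zmod]
  · intro x hx y hy
    obtain ⟨c, rfl⟩ := Ideal.mem_span_singleton.1 hx
    obtain ⟨d, rfl⟩ := Ideal.mem_span_singleton.1 hy
    linear_combination c * d * hz
  · intro t
    refine ⟨((t.val % p ^ r : ℕ) : ZMod ((p ^ r) ^ 2)), Finset.mem_image.2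
      ⟨_, Finset.mem_range.2 (Nat.mod_lt _ hq), rfl⟩, ?_⟩
    have ht : t = ((p ^ r * (t.val / p ^ r) + t.val % p ^ r : ℕ) : ZMod ((p ^ r) ^ 2)) := by
      rw [Nat.div_add_mod, ZMod.natCast_zmod_val]
    refine Ideal.mem_span_singleton.2 ⟨-((t.val / p ^ r : ℕ) : ZMod ((p ^ r) ^ 2)), ?_⟩
    rw [Nat.cast_add, Nat.cast_mul] at ht
    linear_combination -ht
  · intro t ht
    rw [← ZMod.natCast_zmod_val t, ZMod.isUnit_natCast_pow_pow_iff hp hr, not_not] at ht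
    obtain ⟨k, hk⟩ := ht
    refine ⟨((p * (k % p ^ (r - 1)) : ℕ) : ZMod ((p ^ r) ^ 2)), Finset.mem_image.2
      ⟨_, Finset.mem_range.2 (Nat.mod_lt _ (pow_pos hp.pos _)), rfl⟩, ?_⟩
    have ht : t = ((p * (p ^ (r - 1) * (k / p ^ (r - 1)) + k % p ^ (r - 1)) : ℕ) :
        ZMod ((p ^ r) ^ 2)) := by
      rw [Nat.div_add_mod, ← hk, ZMod.natCast_zmod_val]
    refine Ideal.mem_span_singleton.2 ⟨-((k / p ^ (r - 1) : ℕ) : ZMod ((p ^ r) ^ 2)), ?_⟩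
    have hpr : p ^ r = p * p ^ (r - 1) := by rw [← pow_succ', Nat.sub_add_cancel (by omega)]
    have e : ((p ^ r : ℕ) : ZMod ((p ^ r) ^ 2)) = p * (p ^ (r - 1) : ℕ) := by
      rw [← Nat.cast_mul, ← hpr]
    rw [e]
    rw [Nat.cast_mul, Nat.cast_add, Nat.cast_mul] at ht
    rw [Nat.cast_mul]
    linear_combination -ht

/-- Symmetric matrices modulo `ℓ ^ 2` that lie in `isotropicSet q` for every maximal prime power
`q` dividing `ℓ`. -/
def levelSet (ℓ : ℕ) : Set (UpperIndex → ZMod (ℓ ^ 2)) :=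
  {x | ∀ p ∈ ℓ.primeFactors, (fun e => ZMod.castHom
    (pow_dvd_pow_of_dvd (Nat.ordProj_dvd ℓ p) 2) (ZMod ((p ^ ℓ.factorization p) ^ 2)) (x e)) ∈
      isotropicSet (p ^ ℓ.factorization p)}

theorem ZMod.eq_of_castHom_eq {ℓ : ℕ} (hℓ : ℓ ≠ 0) {x y : ZMod (ℓ ^ 2)}
    (h : ∀ p ∈ ℓ.primeFactors, ZMod.castHom (pow_dvd_pow_of_dvd (Nat.ordProj_dvd ℓ p) 2)
      (ZMod ((p ^ ℓ.factorization p) ^ 2)) x = ZMod.castHom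
      (pow_dvd_pow_of_dvd (Nat.ordProj_dvd ℓ p) 2) (ZMod ((p ^ ℓ.factorization p) ^ 2)) y) :
    x = y := by
  have : NeZero (ℓ ^ 2) := ⟨by positivity⟩
  rw [← sub_eq_zero]
  generalize hz : x - y = z
  have h' : ∀ p ∈ ℓ.primeFactors, (p ^ ℓ.factorization p) ^ 2 ∣ z.val := by
    intro p hp
    have h1 := h p hp
    rw [← sub_eq_zero, ← map_sub, hz, ← ZMod.natCast_zmod_val z, map_natCast,
      ZMod.natCast_eq_zero_iff] at h1
    exact h1
  rw [← ZMod.natCast_zmod_val z, ZMod.natCast_eq_zero_iff]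
  have hprod : ℓ ^ 2 = ∏ p ∈ ℓ.primeFactors, (p ^ ℓ.factorization p) ^ 2 := by
    rw [Finset.prod_pow]
    congr 1
    exact (Nat.prod_factorization_pow_eq_self hℓ).symm
  refine (dvd_of_eq hprod).trans ?_
  refine Finset.prod_dvd_of_isRelPrime (fun p hp q hq hpq => ?_) h'
  exact Nat.coprime_iff_isRelPrime.1 (Nat.Coprime.pow _ _ (Nat.Coprime.pow _ _
    ((Nat.coprime_primes (Nat.prime_of_mem_primeFactors hp)
      (Nat.prime_of_mem_primeFactors hq)).2 hpq)))

theorem card_levelSet_le {ℓ : ℕ} (hℓ : ℓ ≠ 0) :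
    Nat.card (levelSet ℓ) ≤
      ∏ p ∈ ℓ.primeFactors, Nat.card (isotropicSet (p ^ ℓ.factorization p)) := by
  let f : levelSet ℓ → ∀ p : ℓ.primeFactors, isotropicSet ((p : ℕ) ^ ℓ.factorization p) :=
    fun x p => ⟨_, x.2 p.1 p.2⟩
  have hf : Function.Injective f := by
    intro x y h
    refine Subtype.ext (funext fun e => ZMod.eq_of_castHom_eq hℓ fun p hp => ?_)
    exact congrFun (congrArg Subtype.val (congrFun h ⟨p, hp⟩)) e
  have : ∀ p : ℓ.primeFactors, NeZero (((p : ℕ) ^ ℓ.factorization p) ^ 2) := fun p =>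
    ⟨by have := (Nat.prime_of_mem_primeFactors p.2).pos; positivity⟩
  refine (Nat.card_le_card_of_injective f hf).trans (le_of_eq ?_)
  rw [Nat.card_pi]
  exact Finset.prod_coe_sort ℓ.primeFactors
    fun p => Nat.card (isotropicSet (p ^ ℓ.factorization p))

/-- The local bound for the density at `p ^ r`. -/
noncomputable def localWeight (p r : ℕ) : ℝ :=
  if r = 0 then 1 else if p = 2 then 0 else (1 + (p : ℝ)⁻¹) * (((p : ℝ) ^ 2)⁻¹) ^ r

/-- The bound for the density at level `ℓ`. -/
noncomputable def levelWeight (ℓ : ℕ) : ℝ := ℓ.factorization.prod localWeight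

theorem card_isotropicSet_div_le {p r : ℕ} (hp : p.Prime) (hp2 : p ≠ 2) (hr : r ≠ 0) :
    (Nat.card (isotropicSet (p ^ r)) : ℝ) / (((p : ℝ) ^ r) ^ 2) ^ 6 ≤ localWeight p r := by
  have hp0 : (0 : ℝ) < p := by exact_mod_cast hp.pos
  rw [localWeight, if_neg hr, if_neg hp2, div_le_iff₀ (by positivity)]
  have h : (Nat.card (isotropicSet (p ^ r)) : ℝ) ≤
      ((p : ℝ) ^ r + (p : ℝ) ^ (r - 1)) * ((p : ℝ) ^ r * (((p : ℝ) ^ r) ^ 2) ^ 4) := by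
    exact_mod_cast card_isotropicSet_le hp hp2 hr
  refine h.trans (le_of_eq ?_)
  obtain ⟨s, rfl⟩ := Nat.exists_eq_succ_of_ne_zero hr
  rw [Nat.succ_sub_one, inv_pow, pow_right_comm]
  have hps : (0 : ℝ) < (p : ℝ) ^ (s + 1) := by positivity
  rw [Nat.succ_eq_add_one]
  field_simp
  rw [pow_succ]
  ring

theorem card_levelSet_div_le {ℓ : ℕ} (hℓ : Odd ℓ) :
    (Nat.card (levelSet ℓ) : ℝ) / ((ℓ : ℝ) ^ 2) ^ 6 ≤ levelWeight ℓ := by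
  have hℓ0 : ℓ ≠ 0 := hℓ.pos.ne'
  have h1 : (Nat.card (levelSet ℓ) : ℝ) ≤
      ∏ p ∈ ℓ.primeFactors, (Nat.card (isotropicSet (p ^ ℓ.factorization p)) : ℝ) := by
    exact_mod_cast card_levelSet_le hℓ0
  have h2 : ((ℓ : ℝ) ^ 2) ^ 6 =
      ∏ p ∈ ℓ.primeFactors, (((p : ℝ) ^ ℓ.factorization p) ^ 2) ^ 6 := by
    rw [Finset.prod_pow, Finset.prod_pow]
    congr 2
    exact_mod_cast (Nat.prod_factorization_pow_eq_self hℓ0).symm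
  refine (div_le_div_of_nonneg_right h1 (by positivity)).trans ?_
  rw [h2, ← Finset.prod_div_distrib]
  refine Finset.prod_le_prod (fun p _ => by positivity) fun p hp => ?_
  refine card_isotropicSet_div_le (Nat.prime_of_mem_primeFactors hp) ?_ ?_
  · rintro rfl
    exact hℓ.not_two_dvd_nat (Nat.dvd_of_mem_primeFactors hp)
  · exact Finsupp.mem_support_iff.1 hp

/-! ### Multiplicativity of the weights and their sum over levels -/

theorem localWeight_nonneg (p r : ℕ) : 0 ≤ localWeight p r := by
  unfold localWeight
  split_ifs <;> positivity

theorem levelWeight_nonneg (ℓ : ℕ) : 0 ≤ levelWeight ℓ := by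
  unfold levelWeight Finsupp.prod
  exact Finset.prod_nonneg fun p _ => localWeight_nonneg p (ℓ.factorization p)

theorem levelWeight_one : levelWeight 1 = 1 := by
  simp [levelWeight]

theorem levelWeight_mul {m n : ℕ} (h : m.Coprime n) :
    levelWeight (m * n) = levelWeight m * levelWeight n := by
  rw [levelWeight, Nat.factorization_mul_of_coprime h]
  exact Finsupp.prod_add_index_of_disjoint h.disjoint_primeFactors localWeight

theorem levelWeight_prime_pow {p : ℕ} (hp : p.Prime) (r : ℕ) :
    levelWeight (p ^ r) = localWeight p r := by
  rw [levelWeight, hp.factorization_pow]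
  exact Finsupp.prod_single_index rfl

/-- A geometric series in `p⁻²`. At `p = 2` only the exponent 0 contributes, matching the absence of
even levels. -/
theorem hasSum_localWeight {p : ℕ} (hp : p.Prime) :
    HasSum (localWeight p) (if p = 2 then 1 else eulerFactor p) := by
  split_ifs with h2
  · have : localWeight p = fun r => if r = 0 then 1 else 0 := by
      funext r
      simp [localWeight, h2]
    rw [this]
    exact hasSum_ite_eq 0 1
  · have h1 : (1 : ℝ) < p := by exact_mod_cast hp.one_lt
    have hx : ((p : ℝ) ^ 2)⁻¹ < 1 := inv_lt_one_of_one_lt₀ (one_lt_pow₀ h1 two_ne_zero)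
    rw [← hasSum_nat_add_iff' 1]
    have hg := ((hasSum_geometric_of_lt_one (by positivity) hx).mul_left
      ((1 + (p : ℝ)⁻¹) * ((p : ℝ) ^ 2)⁻¹))
    have e : (1 + (p : ℝ)⁻¹) * ((p : ℝ) ^ 2)⁻¹ * (1 - ((p : ℝ) ^ 2)⁻¹)⁻¹ =
        eulerFactor p - ∑ i ∈ Finset.range 1, localWeight p i := by
      simp only [Finset.sum_range_one, localWeight, if_true, eulerFactor]
      rw [zpow_neg, zpow_neg]
      norm_cast
      push_cast
      have : (p : ℝ) ^ 2 - 1 ≠ 0 := by nlinarith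
      field_simp
      ring
    rw [e] at hg
    refine hg.congr_fun fun r => ?_
    simp only [localWeight, Nat.add_eq_zero_iff, one_ne_zero, and_false, if_false, h2]
    ring

theorem sum_levelWeight_le (L : ℕ) :
    ∑ ℓ ∈ Finset.Icc 2 L, levelWeight ℓ ≤ 105 * aperyConstant / Real.pi ^ 4 - 1 := by
  have hs : ∀ {p : ℕ}, p.Prime → Summable fun n : ℕ => ‖levelWeight (p ^ n)‖ := by
    intro p hp
    simp only [levelWeight_prime_pow hp, Real.norm_eq_abs, abs_of_nonneg (localWeight_nonneg _ _)]
    exact (hasSum_localWeight hp).summable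
  obtain ⟨-, h⟩ := EulerProduct.summable_and_hasSum_smoothNumbers_prod_primesBelow_tsum
    levelWeight_one (fun h => levelWeight_mul h) hs (L + 1)
  have hprod : ∏ p ∈ (L + 1).primesBelow, ∑' n : ℕ, levelWeight (p ^ n) ≤
      105 * aperyConstant / Real.pi ^ 4 := by
    have e1 : ∏ p ∈ (L + 1).primesBelow, ∑' n : ℕ, levelWeight (p ^ n) =
        ∏ p ∈ (L + 1).primesBelow.filter fun p => p.Prime ∧ Odd p, eulerFactor p := by
      rw [Finset.prod_filter]
      refine Finset.prod_congr rfl fun p hp => ?_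
      have hp' := Nat.prime_of_mem_primesBelow hp
      simp only [levelWeight_prime_pow hp', (hasSum_localWeight hp').tsum_eq]
      by_cases h2 : p = 2
      · simp [h2]
      · rw [if_neg h2, if_pos ⟨hp', hp'.odd_of_ne_two h2⟩]
    rw [e1, ← Finset.prod_subtype_eq_prod_filter]
    exact prod_eulerFactor_le _
  have hsub : ∑ ℓ ∈ Finset.Icc 1 L, levelWeight ℓ ≤
      ∏ p ∈ (L + 1).primesBelow, ∑' n : ℕ, levelWeight (p ^ n) := by
    -- Every level up to `L` has only prime factors below `L + 1`, so it occurs in the expansion of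
    -- the finite Euler product.
    let t : Finset ((L + 1).smoothNumbers) := (Finset.Icc 1 L).subtype (· ∈ (L + 1).smoothNumbers)
    have := sum_le_hasSum t (fun m _ => levelWeight_nonneg m) h
    refine le_trans (le_of_eq ?_) this
    rw [Finset.sum_subtype_of_mem (f := levelWeight)]
    intro m hm
    rw [Finset.mem_Icc] at hm
    exact Nat.mem_smoothNumbers_of_lt (by omega) (by omega)
  rcases Nat.eq_zero_or_pos L with rfl | hL
  · have := prod_eulerFactor_le ∅
    simp at this ⊢
    exact this
  · rw [← Finset.add_sum_Ioc_eq_sum_Icc hL, levelWeight_one] at hsub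
    have e : Finset.Ioc 1 L = Finset.Icc 2 L := rfl
    rw [e] at hsub
    linarith

/-! ### Rational orthogonal matrices and isotropic eigenvectors -/

/-- The integer matrix `P = ℓ Q` attached to a rational orthogonal matrix `Q` of level `ℓ`. -/
theorem exists_integer_multiple {ℓ : ℕ} {Q : Matrix (Fin 3) (Fin 3) ℚ}
    (hQ : Q ∈ orthogonalOfLevel 3 ℓ) :
    ∃ P : Matrix (Fin 3) (Fin 3) ℤ, P.map (Int.cast : ℤ → ℚ) = (ℓ : ℚ) • Q ∧
      P.transpose * P = ((ℓ : ℤ) ^ 2) • (1 : Matrix (Fin 3) (Fin 3) ℤ) ∧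
      ∀ p, p.Prime → p ∣ ℓ → ∃ i j, ¬ (p : ℤ) ∣ P i j := by
  rw [mem_orthogonalOfLevel_iff] at hQ
  obtain ⟨hO, ⟨hℓ, hint⟩, hmin⟩ := hQ
  choose P hP using hint
  have hPQ : (Matrix.of P).map (Int.cast : ℤ → ℚ) = (ℓ : ℚ) • Q := by
    ext i j
    exact (hP i j).symm
  refine ⟨Matrix.of P, hPQ, ?_, ?_⟩
  · apply Matrix.map_injective (Int.cast_injective (α := ℚ))
    have h1 : ((Matrix.of P).transpose * Matrix.of P).map (Int.cast : ℤ → ℚ) =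
        ((Matrix.of P).map (Int.cast : ℤ → ℚ)).transpose * (Matrix.of P).map (Int.cast : ℤ → ℚ) := by
      rw [← Matrix.transpose_map]
      exact Matrix.map_mul (f := Int.castRingHom ℚ)
    beta_reduce
    rw [h1, hPQ, Matrix.transpose_smul, Matrix.smul_mul, Matrix.mul_smul, hO, smul_smul]
    ext i j
    rw [Matrix.map_apply]
    simp only [Matrix.smul_apply, Matrix.one_apply, smul_eq_mul]
    split_ifs <;> push_cast <;> ring
  · intro p hp hpl
    by_contra! hall
    obtain ⟨m, rfl⟩ := hpl
    have hm : 1 ≤ m := by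
      rcases Nat.eq_zero_or_pos m with rfl | h
      · simp at hℓ
      · exact h
    -- If `p` divided every entry of `P`, then `m = ℓ / p` would already clear the denominators of
    -- `Q`.
    have hmem : m ∈ {m : ℕ | 1 ≤ m ∧ IsIntegerMatrix ((m : ℚ) • Q)} := by
      refine ⟨hm, fun i j => ?_⟩
      obtain ⟨c, hc⟩ := hall i j
      refine ⟨c, ?_⟩
      have h := hP i j
      rw [show P i j = (p : ℤ) * c from hc] at h
      have hp0 : (p : ℚ) ≠ 0 := by exact_mod_cast hp.ne_zero
      simp only [Matrix.smul_apply, smul_eq_mul] at h ⊢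
      push_cast at h
      apply mul_left_cancel₀ hp0
      linarith
    have := hmin hmem
    have := hp.two_le
    nlinarith

/-- For even `ℓ` each column of `P` has squared length divisible by 4. Three squares can sum to 0
modulo 4 only if all are even, contradicting primitivity at 2. -/
theorem odd_level {ℓ : ℕ} {Q : Matrix (Fin 3) (Fin 3) ℚ} (hQ : Q ∈ orthogonalOfLevel 3 ℓ) :
    Odd ℓ := by
  obtain ⟨P, -, hPP, hprim⟩ := exists_integer_multiple hQ
  by_contra hodd
  rw [Nat.not_odd_iff_even] at hodd
  obtain ⟨i, j, hij⟩ := hprim 2 Nat.prime_two hodd.two_dvd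
  obtain ⟨m, rfl⟩ := hodd.two_dvd
  have h := congrFun (congrFun hPP j) j
  simp only [Matrix.mul_apply, Matrix.transpose_apply, Fin.sum_univ_three, Matrix.smul_apply,
    Matrix.one_apply_eq, smul_eq_mul, mul_one] at h
  push_cast at h
  have h4 : (P 0 j * P 0 j + P 1 j * P 1 j + P 2 j * P 2 j) % 4 = 0 := by
    rw [h]
    have : ((2 : ℤ) * m) ^ 2 = 4 * m ^ 2 := by ring
    omega
  have key : ∀ x : ℤ, (x * x % 4 = 0 ∧ x % 2 = 0) ∨ (x * x % 4 = 1 ∧ x % 2 = 1) := by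
    intro x
    rcases Int.emod_two_eq_zero_or_one x with hx | hx
    · left
      obtain ⟨y, rfl⟩ := Int.dvd_of_emod_eq_zero hx
      refine ⟨?_, hx⟩
      have : 2 * y * (2 * y) = 4 * (y * y) := by ring
      omega
    · right
      refine ⟨?_, hx⟩
      obtain ⟨y, rfl⟩ : ∃ y, x = 2 * y + 1 := ⟨x / 2, by omega⟩
      have : (2 * y + 1) * (2 * y + 1) = 4 * (y * y + y) + 1 := by ring
      omega
  have k0 := key (P 0 j)
  have k1 := key (P 1 j)
  have k2 := key (P 2 j)
  apply hij
  apply Int.dvd_of_emod_eq_zero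
  push_cast
  fin_cases i <;> simp only [Fin.zero_eta, Fin.mk_one, Fin.reduceFinMk] <;> omega

theorem dvd_minor_of_dvd_cross {d : ℤ} {u w : Fin 3 → ℤ} (h0 : d ∣ u 1 * w 2 - u 2 * w 1)
    (h1 : d ∣ u 2 * w 0 - u 0 * w 2) (h2 : d ∣ u 0 * w 1 - u 1 * w 0) (i k : Fin 3) :
    d ∣ u i * w k - u k * w i := by
  obtain ⟨c0, h0⟩ := h0
  obtain ⟨c1, h1⟩ := h1
  obtain ⟨c2, h2⟩ := h2
  fin_cases i <;> fin_cases k <;> simp only [Fin.zero_eta, Fin.mk_one, Fin.reduceFinMk]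
  · exact ⟨0, by ring⟩
  · exact ⟨c2, by linear_combination h2⟩
  · exact ⟨-c1, by linear_combination -h1⟩
  · exact ⟨-c2, by linear_combination -h2⟩
  · exact ⟨0, by ring⟩
  · exact ⟨c0, by linear_combination h0⟩
  · exact ⟨c1, by linear_combination h1⟩
  · exact ⟨-c0, by linear_combination -h0⟩
  · exact ⟨0, by ring⟩

theorem dvd_minor_of_dvd_adjugate {d : ℤ} {P : Matrix (Fin 3) (Fin 3) ℤ}
    (h : ∀ i j, d ∣ P.adjugate i j) (i k j l : Fin 3) :
    d ∣ P i j * P k l - P k j * P i l := by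
  rw [Matrix.adjugate_fin_three] at h
  have h00 := h 0 0
  have h01 := h 0 1
  have h02 := h 0 2
  have h10 := h 1 0
  have h11 := h 1 1
  have h12 := h 1 2
  have h20 := h 2 0
  have h21 := h 2 1
  have h22 := h 2 2
  simp at h00 h01 h02 h10 h11 h12 h20 h21 h22
  have c01 := dvd_minor_of_dvd_cross (d := d) (u := fun i => P i 0) (w := fun i => P i 1)
    (h20.trans (dvd_of_eq (by ring))) (h21.trans (dvd_of_eq (by ring))) (h22.trans (dvd_of_eq (by ring)))
  have c02 := dvd_minor_of_dvd_cross (d := d) (u := fun i => P i 0) (w := fun i => P i 2)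
    ((dvd_neg.2 h10).trans (dvd_of_eq (by ring))) ((dvd_neg.2 h11).trans (dvd_of_eq (by ring)))
    ((dvd_neg.2 h12).trans (dvd_of_eq (by ring)))
  have c12 := dvd_minor_of_dvd_cross (d := d) (u := fun i => P i 1) (w := fun i => P i 2)
    (h00.trans (dvd_of_eq (by ring))) (h01.trans (dvd_of_eq (by ring))) (h02.trans (dvd_of_eq (by ring)))
  fin_cases j <;> fin_cases l <;> simp only [Fin.zero_eta, Fin.mk_one, Fin.reduceFinMk]
  · exact ⟨0, by ring⟩
  · exact c01 i k
  · exact c02 i k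
  · convert c01 k i using 1; ring
  · exact ⟨0, by ring⟩
  · exact c12 i k
  · convert c02 k i using 1; ring
  · convert c12 k i using 1; ring
  · exact ⟨0, by ring⟩

/-- Here `det P = ±ℓ³`, and comparing with `P Pᵀ = ℓ²` gives `adj P = ±ℓ Pᵀ`. -/
theorem dvd_adjugate {ℓ : ℤ} (hℓ : ℓ ≠ 0) {P : Matrix (Fin 3) (Fin 3) ℤ}
    (hP : P.transpose * P = (ℓ ^ 2) • (1 : Matrix (Fin 3) (Fin 3) ℤ))
    (hP' : P * P.transpose = (ℓ ^ 2) • (1 : Matrix (Fin 3) (Fin 3) ℤ)) (i j : Fin 3) :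
    ℓ ∣ P.adjugate i j := by
  have hdet : P.det ^ 2 = (ℓ ^ 3) ^ 2 := by
    have := congrArg Matrix.det hP
    rw [Matrix.det_mul, Matrix.det_transpose, Matrix.det_smul, Matrix.det_one] at this
    simp only [Fintype.card_fin, mul_one] at this
    linear_combination this
  have hadj : (ℓ ^ 2) • P.adjugate = P.det • P.transpose := by
    calc (ℓ ^ 2) • P.adjugate = P.adjugate * (P * P.transpose) := by
          rw [hP', Matrix.mul_smul, Matrix.mul_one]
      _ = P.det • P.transpose := by
          rw [← Matrix.mul_assoc, Matrix.adjugate_mul, Matrix.smul_mul, Matrix.one_mul]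
  have h := congrFun (congrFun hadj i) j
  simp only [Matrix.smul_apply, smul_eq_mul, Matrix.transpose_apply] at h
  have h2 : ℓ ^ 2 ≠ 0 := pow_ne_zero 2 hℓ
  rcases sq_eq_sq_iff_eq_or_eq_neg.1 hdet with hd | hd <;> rw [hd] at h
  · exact ⟨P j i, mul_left_cancel₀ h2 (by linear_combination h)⟩
  · exact ⟨-P j i, mul_left_cancel₀ h2 (by linear_combination h)⟩

theorem exists_eigenvector_of_isIntegerMatrix {ℓ : ℕ} {Q : Matrix (Fin 3) (Fin 3) ℚ}
    (hQ : Q ∈ orthogonalOfLevel 3 ℓ) {X : Matrix (Fin 3) (Fin 3) ℤ}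
    (hX : IsIntegerMatrix (Q.transpose * X.map (Int.cast : ℤ → ℚ) * Q)) {p : ℕ} (hp : p.Prime)
    (hpl : p ∣ ℓ) :
    ∃ (v : Fin 3 → ℤ) (i₀ : Fin 3) (c : ℤ), ¬ (p : ℤ) ∣ v i₀ ∧ (ℓ : ℤ) ^ 2 ∣ v ⬝ᵥ v ∧
      (ℓ : ℤ) ^ 2 ∣ v ⬝ᵥ X.mulVec v ∧
      ∀ i, (ℓ : ℤ) ∣ v i₀ * X.mulVec v i - c * v i := by
  obtain ⟨P, hPQ, hPP, hprim⟩ := exists_integer_multiple hQ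
  have hℓ0 : (ℓ : ℤ) ≠ 0 := by exact_mod_cast (odd_level hQ).pos.ne'
  have hPP' : P * P.transpose = ((ℓ : ℤ) ^ 2) • (1 : Matrix (Fin 3) (Fin 3) ℤ) := by
    have hQQ : Q * Q.transpose = 1 := (Matrix.mem_orthogonalGroup_iff (Fin 3) ℚ).1 hQ.1
    apply Matrix.map_injective (Int.cast_injective (α := ℚ))
    have h1 : (P * P.transpose).map (Int.cast : ℤ → ℚ) =
        P.map (Int.cast : ℤ → ℚ) * (P.map (Int.cast : ℤ → ℚ)).transpose := by
      rw [← Matrix.transpose_map]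
      exact Matrix.map_mul (f := Int.castRingHom ℚ)
    beta_reduce
    rw [h1, hPQ, Matrix.transpose_smul, Matrix.smul_mul, Matrix.mul_smul, hQQ, smul_smul]
    ext i j
    rw [Matrix.map_apply]
    simp only [Matrix.smul_apply, Matrix.one_apply, smul_eq_mul]
    split_ifs <;> push_cast <;> ring
  choose Y hY using hX
  have hXP : P.transpose * X * P = ((ℓ : ℤ) ^ 2) • Matrix.of Y := by
    apply Matrix.map_injective (Int.cast_injective (α := ℚ))
    have h1 : (P.transpose * X * P).map (Int.cast : ℤ → ℚ) =
        (P.map (Int.cast : ℤ → ℚ)).transpose * X.map (Int.cast : ℤ → ℚ) *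
          P.map (Int.cast : ℤ → ℚ) := by
      rw [← Matrix.transpose_map]
      exact (Matrix.map_mul (f := Int.castRingHom ℚ)).trans
        (congrArg (· * _) (Matrix.map_mul (f := Int.castRingHom ℚ)))
    beta_reduce
    rw [h1, hPQ, Matrix.transpose_smul, Matrix.smul_mul, Matrix.smul_mul, Matrix.mul_smul,
      smul_smul]
    ext i j
    simp [hY, pow_two]
  have hcomm : X * P = P * Matrix.of Y := by
    have h1 : P * (P.transpose * X * P) = ((ℓ : ℤ) ^ 2) • (X * P) := by
      rw [Matrix.mul_assoc, ← Matrix.mul_assoc, hPP', Matrix.smul_mul, Matrix.one_mul]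
    rw [hXP, Matrix.mul_smul] at h1
    exact (smul_right_injective _ (pow_ne_zero 2 hℓ0) h1).symm
  have hminor := dvd_minor_of_dvd_adjugate (dvd_adjugate hℓ0 hPP hPP')
  obtain ⟨i₀, j, hij⟩ := hprim p hp hpl
  -- The vector is a column of `P` through an entry prime to `p`; `c` is entry `i₀` of `X v`, so the
  -- last condition is division-free proportionality. It follows from `X P = P Y` and the vanishing
  -- of minors modulo `ℓ`.
  refine ⟨fun i => P i j, i₀, ∑ k, P i₀ k * Y k j, hij, ?_, ?_, ?_⟩
  · have := congrFun (congrFun hPP j) j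
    simp only [Matrix.mul_apply, Matrix.transpose_apply, Matrix.smul_apply, Matrix.one_apply_eq,
      smul_eq_mul, mul_one] at this
    exact ⟨1, by rw [mul_one]; exact this⟩
  · have := congrFun (congrFun hXP j) j
    rw [Matrix.mul_assoc] at this
    exact ⟨Y j j, this⟩
  · intro i
    have h1 : X.mulVec (fun i => P i j) i = ∑ k, P i k * Y k j := by
      have := congrFun (congrFun hcomm i) j
      rw [Matrix.mul_apply (N := Matrix.of Y)] at this
      exact this
    rw [h1, Finset.mul_sum, Finset.sum_mul, ← Finset.sum_sub_distrib]
    refine Finset.dvd_sum fun k _ => ?_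
    have h2 := (hminor i₀ i j k).mul_right (Y k j)
    convert h2 using 1
    ring

theorem mem_levelSet_of_isIntegerMatrix {ℓ : ℕ} {Q : Matrix (Fin 3) (Fin 3) ℚ}
    (hQ : Q ∈ orthogonalOfLevel 3 ℓ) {x : UpperIndex → ℤ}
    (hX : IsIntegerMatrix (Q.transpose * (symmetricOf x).map (Int.cast : ℤ → ℚ) * Q)) :
    (fun e => (x e : ZMod (ℓ ^ 2))) ∈ levelSet ℓ := by
  intro p hp
  have hpp := Nat.prime_of_mem_primeFactors hp
  have hpl := Nat.dvd_of_mem_primeFactors hp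
  obtain ⟨v, i₀, c, hv0, hvv, hvX, hc⟩ := exists_eigenvector_of_isIntegerMatrix hQ hX hpp hpl
  set q := p ^ ℓ.factorization p with hq
  have hql : (q : ℤ) ∣ ℓ := by exact_mod_cast Nat.ordProj_dvd ℓ p
  have hr : ℓ.factorization p ≠ 0 := Finsupp.mem_support_iff.1 hp
  let φ := Int.castRingHom (ZMod (q ^ 2))
  have hzero : ∀ z : ℤ, (ℓ : ℤ) ^ 2 ∣ z → φ z = 0 := by
    intro z hz
    have : ((q ^ 2 : ℕ) : ℤ) ∣ z := by
      push_cast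
      exact (pow_dvd_pow_of_dvd hql 2).trans hz
    exact (ZMod.intCast_zmod_eq_zero_iff_dvd z (q ^ 2)).2 this
  have hunit : IsUnit (φ (v i₀)) := by
    refine (ZMod.coe_int_isUnit_iff_isCoprime _ _).2 ?_
    have : IsCoprime (p : ℤ) (v i₀) :=
      (Nat.prime_iff_prime_int.1 hpp).coprime_iff_not_dvd.2 hv0
    rw [hq]
    push_cast
    exact (this.pow_left).pow_left
  have hmap : symmetricOf (fun e => ZMod.castHom (pow_dvd_pow_of_dvd (Nat.ordProj_dvd ℓ p) 2)
      (ZMod (q ^ 2)) (x e : ZMod (ℓ ^ 2))) = (symmetricOf x).map φ := by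
    ext i j
    simp [symmetricOf, φ]
  obtain ⟨z, hz⟩ := hunit.exists_right_inv
  have hmv : ∀ i, ((symmetricOf x).map φ).mulVec (φ ∘ v) i = φ ((symmetricOf x).mulVec v i) :=
    fun i => (RingHom.map_mulVec φ _ _ i).symm
  refine ⟨φ ∘ v, ⟨i₀, hunit⟩, ?_, ?_, z * φ c, fun i => ?_⟩
  · rw [← RingHom.map_dotProduct]
    exact hzero _ hvv
  · rw [hmap]
    have : ((symmetricOf x).map φ).mulVec (φ ∘ v) = φ ∘ ((symmetricOf x).mulVec v) :=
      funext hmv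
    rw [this, ← RingHom.map_dotProduct]
    exact hzero _ hvX
  · rw [hmap, hmv]
    obtain ⟨d, hd⟩ := hql.trans (hc i)
    refine Ideal.mem_span_singleton.2 ⟨z * φ d, ?_⟩
    have hd' := congrArg φ hd
    simp only [map_sub, map_mul] at hd'
    have hqq : φ (q : ℤ) = (q : ZMod (q ^ 2)) := by simp [φ]
    rw [hqq] at hd'
    change φ ((symmetricOf x).mulVec v i) - z * φ c * φ (v i) = _
    linear_combination z * hd' - φ ((symmetricOf x).mulVec v i) * hz

/-! ### Densities of residue conditions -/

theorem uniformOn_Icc_real_residue {N : ℕ} {k : ℕ} (b : ZMod N) :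
    (uniformOn (Set.Icc (1 : ℤ) (k : ℤ))).real {z : ℤ | (z : ZMod N) = b} =
      (((Finset.Ioc (0 : ℤ) k).filter fun z : ℤ => (z : ZMod N) = b).card : ℝ) / k := by
  have hs : Set.Icc (1 : ℤ) (k : ℤ) = ((Finset.Ioc (0 : ℤ) k : Finset ℤ) : Set ℤ) := by
    rw [Finset.coe_Ioc]
    rfl
  rw [measureReal_def, ← uniformOn_inter_self (Set.finite_Icc _ _), hs]
  have ht : ((Finset.Ioc (0 : ℤ) k : Finset ℤ) : Set ℤ) ∩ {z : ℤ | (z : ZMod N) = b} =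
      (((Finset.Ioc (0 : ℤ) k).filter fun z : ℤ => (z : ZMod N) = b : Finset ℤ) : Set ℤ) := by
    ext z
    simp
  rw [ht, uniformOn_apply_finset, Finset.inter_eq_right.2 (Finset.filter_subset _ _),
    ENNReal.toReal_div, Int.card_Ioc]
  simp

/-- The count is a difference of two floors whose arguments differ by exactly `k / N`. -/
theorem abs_card_residue_sub_le {N : ℕ} [NeZero N] (b : ZMod N) (k : ℕ) :
    |(((Finset.Ioc (0 : ℤ) k).filter fun z : ℤ => (z : ZMod N) = b).card : ℝ) - k / N| ≤ 1 := by
  have hN : (0 : ℤ) < N := by exact_mod_cast Nat.pos_of_ne_zero (NeZero.ne N)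
  have h := Int.Ioc_filter_modEq_card 0 (k : ℤ) hN (b.val : ℤ)
  have e : ((Finset.Ioc (0 : ℤ) k).filter fun z : ℤ => (z : ZMod N) = b) =
      (Finset.Ioc (0 : ℤ) k).filter fun z : ℤ => z ≡ b.val [ZMOD N] := by
    refine Finset.filter_congr fun z _ => ?_
    rw [← ZMod.intCast_eq_intCast_iff, Int.cast_natCast, ZMod.natCast_zmod_val]
  rw [e]
  generalize ((Finset.Ioc (0 : ℤ) k).filter fun z : ℤ => z ≡ b.val [ZMOD N]).card = c at h
  have hmono : ⌊((0 : ℤ) - (b.val : ℤ) : ℚ) / (N : ℤ)⌋ ≤ ⌊((k : ℤ) - (b.val : ℤ) : ℚ) / (N : ℤ)⌋ := by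
    apply Int.floor_le_floor
    have : (0 : ℚ) < (N : ℤ) := by exact_mod_cast hN
    gcongr
    simp
  rw [max_eq_left (by linarith)] at h
  have h1 := Int.floor_le (((0 : ℤ) - (b.val : ℤ) : ℚ) / (N : ℤ))
  have h2 := Int.lt_floor_add_one (((0 : ℤ) - (b.val : ℤ) : ℚ) / (N : ℤ))
  have h3 := Int.floor_le (((k : ℤ) - (b.val : ℤ) : ℚ) / (N : ℤ))
  have h4 := Int.lt_floor_add_one (((k : ℤ) - (b.val : ℤ) : ℚ) / (N : ℤ))
  have hc : (c : ℚ) = (⌊((k : ℤ) - (b.val : ℤ) : ℚ) / (N : ℤ)⌋ : ℚ) -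
      (⌊((0 : ℤ) - (b.val : ℤ) : ℚ) / (N : ℤ)⌋ : ℚ) := by exact_mod_cast h
  have hq : |(c : ℚ) - k / N| ≤ 1 := by
    have e3 : ((k : ℤ) - (b.val : ℤ) : ℚ) / (N : ℤ) - ((0 : ℤ) - (b.val : ℤ) : ℚ) / (N : ℤ) =
        k / N := by
      push_cast
      ring
    rw [abs_le]
    constructor <;> linarith
  have hr : ((|(c : ℚ) - k / N| : ℚ) : ℝ) ≤ ((1 : ℚ) : ℝ) := Rat.cast_le.2 hq
  push_cast at hr
  exact hr

theorem tendsto_uniformOn_Icc_residue {N : ℕ} [NeZero N] (b : ZMod N) :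
    Tendsto (fun k : ℕ => (uniformOn (Set.Icc (1 : ℤ) (k : ℤ))).real {z : ℤ | (z : ZMod N) = b})
      atTop (𝓝 (1 / (N : ℝ))) := by
  simp only [uniformOn_Icc_real_residue]
  rw [tendsto_iff_norm_sub_tendsto_zero]
  refine squeeze_zero' (Eventually.of_forall fun _ => norm_nonneg _) ?_
    (tendsto_one_div_atTop_nhds_zero_nat (𝕜 := ℝ))
  filter_upwards [eventually_ge_atTop 1] with k hk
  have hk0 : (0 : ℝ) < k := by exact_mod_cast hk
  have h := abs_card_residue_sub_le b k
  have hN : (N : ℝ) ≠ 0 := by exact_mod_cast NeZero.ne N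
  generalize (((Finset.Ioc (0 : ℤ) k).filter fun z : ℤ => (z : ZMod N) = b).card : ℝ) = c at h
  have e : c / k - 1 / N = (c - k / N) / k := by
    field_simp
  rw [e, Real.norm_eq_abs, abs_div, abs_of_pos hk0]
  gcongr

theorem card_upperIndex : Fintype.card UpperIndex = 6 := by decide

/-- The entries of `X` on and above the diagonal. -/
def upperEntries {R : Type*} (X : Matrix (Fin 3) (Fin 3) R) : UpperIndex → R :=
  fun e => X e.1.1 e.1.2

theorem symmetricOf_upperEntries {R : Type*} {X : Matrix (Fin 3) (Fin 3) R} (hX : X.IsSymm) :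
    symmetricOf (upperEntries X) = X := by
  ext i j
  rcases le_total i j with h | h
  · simp [symmetricOf, upperEntries, h]
  · simp [symmetricOf, upperEntries, h, hX.apply i j]

theorem IsUniformSymmetric.real_residue {Ω : Type*} [MeasurableSpace Ω] {P : Measure Ω}
    [IsProbabilityMeasure P] {k : ℕ} {X : Ω → Matrix (Fin 3) (Fin 3) ℤ}
    (hX : IsUniformSymmetric P 3 k X) {N : ℕ} [NeZero N] (B : Finset (UpperIndex → ZMod N)) :
    P.real {ω | (fun e => ((upperEntries (X ω) e : ℤ) : ZMod N)) ∈ B} =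
      ∑ b ∈ B, ∏ e, (uniformOn (Set.Icc (1 : ℤ) (k : ℤ))).real {z : ℤ | (z : ZMod N) = b e} := by
  let F : (UpperIndex → ZMod N) → Set Ω := fun b =>
    ⋂ e ∈ (Finset.univ : Finset UpperIndex),
      (fun ω => X ω e.1.1 e.1.2) ⁻¹' {z : ℤ | (z : ZMod N) = b e}
  have hset : {ω | (fun e => ((upperEntries (X ω) e : ℤ) : ZMod N)) ∈ B} = ⋃ b ∈ B, F b := by
    ext ω
    simp only [Set.mem_ofPred_eq, Set.mem_iUnion, F, Set.mem_iInter, Set.mem_preimage, exists_prop]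
    constructor
    · intro h
      exact ⟨_, h, fun e _ => rfl⟩
    · rintro ⟨b, hb, h⟩
      have : (fun e => ((upperEntries (X ω) e : ℤ) : ZMod N)) = b :=
        funext fun e => h e (Finset.mem_univ e)
      rwa [this]
  have hmeas : ∀ b, MeasurableSet (F b) := fun b =>
    Finset.measurableSet_biInter _ fun e _ => hX.measurable _ _ (MeasurableSet.of_discrete)
  have hdisj : (B : Set (UpperIndex → ZMod N)).PairwiseDisjoint F := by
    intro b _ b' _ hbb
    refine Set.disjoint_left.2 fun ω h h' => hbb (funext fun e => ?_)
    simp only [F, Set.mem_iInter, Set.mem_preimage, Set.mem_ofPred_eq] at h h'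
    rw [← h e (Finset.mem_univ e), ← h' e (Finset.mem_univ e)]
  rw [hset, measureReal_biUnion_finset hdisj fun b _ => hmeas b]
  refine Finset.sum_congr rfl fun b _ => ?_
  have hind := hX.indep.measure_inter_preimage_eq_mul Finset.univ
    (sets := fun e : UpperIndex => {z : ℤ | (z : ZMod N) = b e})
    fun _ _ => MeasurableSet.of_discrete
  rw [measureReal_def, hind, ENNReal.toReal_prod]
  refine Finset.prod_congr rfl fun e _ => ?_
  rw [measureReal_def, ← hX.uniform e.1.1 e.1.2 e.2,
    Measure.map_apply (hX.measurable _ _) MeasurableSet.of_discrete]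

theorem tendsto_real_residue {Ω : ℕ → Type*} [∀ k, MeasurableSpace (Ω k)]
    (P : (k : ℕ) → Measure (Ω k)) [∀ k, IsProbabilityMeasure (P k)]
    (X : (k : ℕ) → Ω k → Matrix (Fin 3) (Fin 3) ℤ)
    (hX : ∀ k, 1 ≤ k → IsUniformSymmetric (P k) 3 k (X k)) {N : ℕ} [NeZero N]
    (B : Set (UpperIndex → ZMod N)) :
    Tendsto (fun k => (P k).real {ω | (fun e => ((upperEntries (X k ω) e : ℤ) : ZMod N)) ∈ B}) atTop
      (𝓝 (Nat.card B / (N : ℝ) ^ 6)) := by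
  classical
  have hlim : Tendsto (fun k : ℕ => ∑ b ∈ B.toFinset, ∏ e,
      (uniformOn (Set.Icc (1 : ℤ) (k : ℤ))).real {z : ℤ | (z : ZMod N) = b e}) atTop
      (𝓝 (∑ b ∈ B.toFinset, ∏ _e : UpperIndex, 1 / (N : ℝ))) :=
    tendsto_finsetSum _ fun b _ => tendsto_finsetProd _ fun e _ =>
      tendsto_uniformOn_Icc_residue (b e)
  have hval : ∑ b ∈ B.toFinset, ∏ _e : UpperIndex, 1 / (N : ℝ) = Nat.card B / (N : ℝ) ^ 6 := by
    rw [Finset.sum_const, Finset.prod_const, Finset.card_univ, card_upperIndex, nsmul_eq_mul,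
      Set.toFinset_card, Nat.card_eq_fintype_card]
    ring
  rw [← hval]
  refine hlim.congr' ?_
  filter_upwards [eventually_ge_atTop 1] with k hk
  rw [← (hX k hk).real_residue B.toFinset]
  simp only [Set.mem_toFinset]

/-! ### The iterated limit -/

/-- Every `ℓ ≤ L` in play divides `L!`, so the change in `X` is `ℓ² D` with `D` integral, and `Qᵀ(ℓ²
D)Q = PᵀDP` is integral. -/
theorem hasRationalConjugate_congr {L : ℕ} {X X' : Matrix (Fin 3) (Fin 3) ℤ}
    (h : ∀ i j, ((L.factorial : ℤ) ^ 2) ∣ X' i j - X i j) (hX : HasRationalConjugate L X) :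
    HasRationalConjugate L X' := by
  obtain ⟨ℓ, hℓ, Q, hQ, hint⟩ := hX
  refine ⟨ℓ, hℓ, Q, hQ, fun i j => ?_⟩
  rw [Finset.mem_Icc] at hℓ
  obtain ⟨P, hPQ, -⟩ := exists_integer_multiple hQ
  have hℓd : (ℓ : ℤ) ∣ L.factorial := by
    exact_mod_cast Nat.dvd_factorial (by omega) hℓ.2
  have hD : ∀ i j, ∃ d : ℤ, X' i j - X i j = ℓ ^ 2 * d := fun i j =>
    (pow_dvd_pow_of_dvd hℓd 2).trans (h i j)
  choose D hD using hD
  obtain ⟨z, hz⟩ := hint i j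
  refine ⟨z + (P.transpose * Matrix.of D * P) i j, ?_⟩
  have e1 : X'.map (Int.cast : ℤ → ℚ) = X.map (Int.cast : ℤ → ℚ) +
      ((ℓ : ℚ) ^ 2) • (Matrix.of D).map (Int.cast : ℤ → ℚ) := by
    ext a b
    have := hD a b
    simp only [Matrix.map_apply, Matrix.add_apply, Matrix.smul_apply, smul_eq_mul, Matrix.of_apply]
    rw [show X' a b = X a b + ℓ ^ 2 * D a b by linarith]
    push_cast
    ring
  have e2 : (P.transpose * Matrix.of D * P).map (Int.cast : ℤ → ℚ) =
      ((ℓ : ℚ) ^ 2) • (Q.transpose * (Matrix.of D).map (Int.cast : ℤ → ℚ) * Q) := by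
    have h1 : (P.transpose * Matrix.of D * P).map (Int.cast : ℤ → ℚ) =
        (P.map (Int.cast : ℤ → ℚ)).transpose * (Matrix.of D).map (Int.cast : ℤ → ℚ) *
          P.map (Int.cast : ℤ → ℚ) := by
      rw [← Matrix.transpose_map]
      exact (Matrix.map_mul (f := Int.castRingHom ℚ)).trans
        (congrArg (· * _) (Matrix.map_mul (f := Int.castRingHom ℚ)))
    rw [h1, hPQ, Matrix.transpose_smul, Matrix.smul_mul, Matrix.smul_mul, Matrix.mul_smul,
      smul_smul, pow_two]
  have e3 := congrFun (congrFun e2 i) j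
  rw [Matrix.map_apply] at e3
  rw [e1, Matrix.mul_add, Matrix.add_mul, Matrix.add_apply, hz, Matrix.mul_smul, Matrix.smul_mul,
    ← e3]
  push_cast
  rfl

theorem hasRationalConjugate_iff_residue (L : ℕ) {X : Matrix (Fin 3) (Fin 3) ℤ} (hX : X.IsSymm) :
    HasRationalConjugate L X ↔ (fun e => ((upperEntries X e : ℤ) : ZMod (L.factorial ^ 2))) ∈
      {y : UpperIndex → ZMod (L.factorial ^ 2) | ∃ x : UpperIndex → ℤ,
        HasRationalConjugate L (symmetricOf x) ∧ ∀ e, (x e : ZMod (L.factorial ^ 2)) = y e} := by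
  constructor
  · intro h
    exact ⟨upperEntries X, by rwa [symmetricOf_upperEntries hX], fun e => rfl⟩
  · rintro ⟨x, hx, hxy⟩
    rw [← symmetricOf_upperEntries hX]
    refine hasRationalConjugate_congr (fun i j => ?_) hx
    have := (ZMod.intCast_eq_intCast_iff_dvd_sub _ _ _).1 (hxy ⟨(min i j, max i j), min_le_max⟩)
    exact_mod_cast this

theorem HasRationalConjugate.exists_levelSet {L : ℕ} {X : Matrix (Fin 3) (Fin 3) ℤ}
    (hX : X.IsSymm) (h : HasRationalConjugate L X) :
    ∃ ℓ ∈ (Finset.Icc 2 L).filter Odd, (fun e => ((upperEntries X e : ℤ) : ZMod (ℓ ^ 2))) ∈ levelSet ℓ := by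
  obtain ⟨ℓ, hℓ, Q, hQ, hint⟩ := h
  refine ⟨ℓ, Finset.mem_filter.2 ⟨hℓ, odd_level hQ⟩, mem_levelSet_of_isIntegerMatrix hQ ?_⟩
  rwa [symmetricOf_upperEntries hX]

theorem exists_iterated_limit {Ω : ℕ → Type*} [∀ k, MeasurableSpace (Ω k)]
    (P : (k : ℕ) → Measure (Ω k)) [∀ k, IsProbabilityMeasure (P k)]
    (X : (k : ℕ) → Ω k → Matrix (Fin 3) (Fin 3) ℤ)
    (hX : ∀ k, 1 ≤ k → IsUniformSymmetric (P k) 3 k (X k)) :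
    ∃ (p : ℕ → ℝ) (q : ℝ),
      (∀ L : ℕ, Tendsto (fun k => (P k).real {ω | HasRationalConjugate L (X k ω)})
        atTop (𝓝 (p L))) ∧
      Tendsto p atTop (𝓝 q) ∧ q ≤ 105 * aperyConstant / Real.pi ^ 4 - 1 := by
  have hlim : ∀ L : ℕ, ∃ c : ℝ,
      Tendsto (fun k => (P k).real {ω | HasRationalConjugate L (X k ω)}) atTop (𝓝 c) := by
    intro L
    have : NeZero (L.factorial ^ 2) := ⟨by positivity⟩
    refine ⟨_, (tendsto_real_residue P X hX (N := L.factorial ^ 2)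
      {y | ∃ x : UpperIndex → ℤ, HasRationalConjugate L (symmetricOf x) ∧
        ∀ e, (x e : ZMod (L.factorial ^ 2)) = y e}).congr' ?_⟩
    filter_upwards [eventually_ge_atTop 1] with k hk
    congr 1
    ext ω
    exact (hasRationalConjugate_iff_residue L ((hX k hk).isSymm ω)).symm
  choose p hp using hlim
  have hmono : Monotone p := by
    intro L L' hL
    refine le_of_tendsto_of_tendsto' (hp L) (hp L') fun k => measureReal_mono ?_
    rintro ω ⟨ℓ, hℓ, h⟩
    exact ⟨ℓ, Finset.Icc_subset_Icc_right hL hℓ, h⟩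
  have hbound : ∀ L, p L ≤ 105 * aperyConstant / Real.pi ^ 4 - 1 := by
    intro L
    have h1 : p L ≤ ∑ ℓ ∈ (Finset.Icc 2 L).filter Odd,
        (Nat.card (levelSet ℓ) : ℝ) / ((ℓ ^ 2 : ℕ) : ℝ) ^ 6 := by
      have hsum : Tendsto (fun k => ∑ ℓ ∈ (Finset.Icc 2 L).filter Odd, (P k).real
          {ω | (fun e => ((upperEntries (X k ω) e : ℤ) : ZMod (ℓ ^ 2))) ∈ levelSet ℓ}) atTop
          (𝓝 (∑ ℓ ∈ (Finset.Icc 2 L).filter Odd,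
            (Nat.card (levelSet ℓ) : ℝ) / ((ℓ ^ 2 : ℕ) : ℝ) ^ 6)) := by
        refine tendsto_finsetSum _ fun ℓ hℓ => ?_
        have : NeZero (ℓ ^ 2) := ⟨pow_ne_zero 2 (Finset.mem_filter.1 hℓ).2.pos.ne'⟩
        exact tendsto_real_residue P X hX (levelSet ℓ)
      refine le_of_tendsto_of_tendsto (hp L) hsum ?_
      filter_upwards [eventually_ge_atTop 1] with k hk
      refine le_trans (measureReal_mono ?_ (measure_ne_top _ _)) (measureReal_biUnion_finset_le _ _)
      intro ω hω
      obtain ⟨ℓ, hℓ, h⟩ := HasRationalConjugate.exists_levelSet ((hX k hk).isSymm ω) hω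
      exact Set.mem_biUnion hℓ h
    refine h1.trans (le_trans ?_ (sum_levelWeight_le L))
    refine (Finset.sum_le_sum fun ℓ hℓ => ?_).trans
      (Finset.sum_le_sum_of_subset_of_nonneg (Finset.filter_subset _ _)
        fun ℓ _ _ => levelWeight_nonneg ℓ)
    rw [Nat.cast_pow]
    exact card_levelSet_div_le (Finset.mem_filter.1 hℓ).2
  have hbdd : BddAbove (Set.range p) := ⟨_, Set.forall_mem_range.2 hbound⟩
  exact ⟨p, _, hp, tendsto_atTop_ciSup hmono hbdd, ciSup_le hbound⟩

theorem mainTheorem10 {Ω : ℕ → Type*} [∀ k, MeasurableSpace (Ω k)]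
    (P : (k : ℕ) → Measure (Ω k)) [∀ k, IsProbabilityMeasure (P k)]
    (X : (k : ℕ) → Ω k → Matrix (Fin 3) (Fin 3) ℤ)
    (hX : ∀ k, 1 ≤ k → IsUniformSymmetric (P k) 3 k (X k)) :
    -- both limits exist and the iterated limit `q` obeys the bound
    (∃ (p : ℕ → ℝ) (q : ℝ),
      (∀ L : ℕ, Tendsto (fun k => (P k).real {ω | HasRationalConjugate L (X k ω)})
        atTop (𝓝 (p L))) ∧
      Tendsto p atTop (𝓝 q) ∧
      q ≤ 105 * aperyConstant / Real.pi ^ 4 - 1) ∧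
    -- the constant `ζ(3)` and the numerical value of the bound
    (HasSum (fun m : ℕ => 1 / ((m : ℝ) + 1) ^ 3) aperyConstant ∧
      (aperyConstant : ℂ) = riemannZeta 3 ∧
      aperyConstant ∈ Set.Ico (1.2020569031 : ℝ) 1.2020569032 ∧
      105 * aperyConstant / Real.pi ^ 4 - 1 ∈ Set.Ico (0.29573 : ℝ) 0.29574) ∧
    -- the Euler product over the odd primes
    (HasProd (fun p : {p : ℕ // p.Prime ∧ Odd p} =>
        (1 + ((p : ℕ) : ℝ) ^ (-3 : ℤ)) / (1 - ((p : ℕ) : ℝ) ^ (-2 : ℤ)))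
        (105 * aperyConstant / Real.pi ^ 4) ∧
      ((105 * aperyConstant / Real.pi ^ 4 : ℝ) : ℂ) =
        2 / 3 * (riemannZeta 2 * riemannZeta 3 / riemannZeta 6)) := by
  exact ⟨exists_iterated_limit P X hX, ⟨hasSum_aperyConstant, aperyConstant_eq_riemannZeta,
    aperyConstant_mem_Ico, bound_mem_Ico⟩, hasProd_eulerFactor_odd, two_thirds_zeta_eq⟩
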